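/- Let $\mathbb k$ be a field and $k\ge 1$. Let $(\mathbb P^1)^{[k]}$ be the Hilbert scheme over $\mathbb k$ parametrizing homogeneous ideals $I$ of $R=\mathbb k[x,y]$ with Hilbert function $\dim R_d/I_d=d+1$ for $d<k$ and $=k$ for $d\ge k$; so the $A$-points, for a commutative $\mathbb k$-algebra $A$, are the homogeneous ideals $I\subseteq A[x,y]$ such that each $\mathcal Q_d=A[x,y]_d/I_d$ is locally free of rank $d+1$ for $d<k$ and of rank $k$ for $d\ge k$. For a set $U$ of $\ell$ monomials of degree $d$, the dependence scheme $\mathcal D(U)$ is the zero scheme of the section $\sigma_U=\bigwedge_{m\in U}m$ of $\bigwedge^{\ell}\mathcal Q_d$. Use the isomorphisms $(\mathbb P^1)^{[k]}\cong\mathbb P^k\cong\operatorname{Sym}^k\mathbb P^1$ that match the ideal generated by $a_0x^k+a_1x^{k-1}y+\dots+a_ky^k=\prod_{i=1}^k(y_ix-x_iy)$, the point $[a_0:\dots:a_k]$, and the set of roots $[x_1:y_1],\dots,[x_k:y_k]$. Sections of $\mathcal O(n)$ on $\mathbb P^k$ are thereby identified with the symmetric polynomials in the pairs $(x_i,y_i)$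 that are homogeneous of degree $n$ in each pair, and each of these has a zero scheme in $(\mathbb P^1)^{[k]}$. Put $e_0=y_1\cdots y_k$ and, for a partition $\lambda=(\lambda_1\ge\dots\ge\lambda_k\ge 0)$ with at most $k$ parts, let $$s_\lambda=\frac{a_{(\lambda_1+k-1,\lambda_2+k-2,\dots,\lambda_k)}}{a_{(k-1,k-2,\dots,0)}},\qquad a_{(l_1,\dots,l_k)}=\det\bigl(x_j^{l_i}y_j^{\,l_1-l_i}\bigr)_{i,j},$$ be the bihomogeneous Schur polynomial, which has degree $\lambda_1$ in each pair. Let $h\ge 1$ and let $\lambda$ have at most $k$ parts and $\lambda_1\le h$. The rim path of $\lambda$ is the lattice path from $(h,0)$ to $(0,-k)$ that follows the edge of the Young diagram (English notation) down and to the left; its steps are numbered $0,\dots,h+k-1$. Let $U_\lambda^{h,k}$ be the $k$-element set of those monomials $x^{h+k-1-i}y^i$ for which step $i$ is vertical. **Theorem.** (1) For all such $h$ and $\lambda$, the subscheme $\mathcal D(U_\lambda^{h,k})\subseteq(\mathbb P^1)^{[k]}$ is the zero scheme of the section $e_0^{\,h-\lambda_1}s_\lambda$ of $\mathcal O(h)$.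 (2) Consequently, the matroid stratification of $(\mathbb P^1)^{[k]}$ is generated by $e_0$ and the Schur polynomials in $k$ variables. That is, let $K/\mathbb k$ be a field extension and $J$ a $K$-point, and let $\operatorname{Trop}(J)_d$ be the matroid on the monomials of degree $d$ with rank function $r(S)=\dim_K K^S/(J_d\cap K^S)$. Then the matroid stratum of $\operatorname{Trop}(J)$, i.e. the intersection, over all $d$ and all sets $U$ of monomials of degree $d$, of the $\mathcal D(U)$ with $U$ dependent in $\operatorname{Trop}(J)_d$ and of the complements of the $\mathcal D(U)$ with $U$ independent, coincides scheme-theoretically with the intersection, over all $G\in\{e_0\}\cup\{s_\lambda:\lambda\text{ has at most }k\text{ parts}\}$, of the zero schemes of the $G$ that vanish at $J$ and of the complements of the zero schemes of the $G$ that do not. -/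

import Mathlib

universe u v w

open scoped TensorProduct

noncomputable section

namespace HilbP1

/-! ### Forms in two variables, monomials -/

/-- The `A`-module of forms of degree `d` in `A[x, y]`, where `x = X 0` and `y = X 1`. -/
abbrev Forms (A : Type v) [CommRing A] (d : ℕ) : Submodule A (MvPolynomial (Fin 2) A) :=
  MvPolynomial.homogeneousSubmodule (Fin 2) A d

/-- The exponent vector of the monomial `x ^ (d - i) * y ^ i`. -/
def expo (d i : ℕ) : Fin 2 →₀ ℕ := Finsupp.single 0 (d - i) + Finsupp.single 1 i

/-- The monomial `x ^ (d - i) * y ^ i` of degree `d`, for `0 ≤ i ≤ d`. The set of monomials of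
degree `d` is indexed by the `y`-exponent `i : Fin (d + 1)`; sets of monomials of degree `d` are
thus finsets of `Fin (d + 1)`. -/
def mono (A : Type v) [CommRing A] (d : ℕ) (i : Fin (d + 1)) : Forms A d :=
  ⟨MvPolynomial.monomial (expo d i) 1, by
    rw [MvPolynomial.mem_homogeneousSubmodule]
    apply MvPolynomial.isHomogeneous_monomial
    have := i.is_le
    rw [expo, map_add, Finsupp.degree_single, Finsupp.degree_single]
    omega⟩

/-! ### The Hilbert scheme, through its functor of points -/

/-- The Hilbert function of a principal ideal of `K[x, y]` generated by a form of degree `k`. -/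
def hilbFun (k d : ℕ) : ℕ := if d < k then d + 1 else k

/-- The degree `d` piece `I_d` of an ideal `I` of `A[x, y]`, as a submodule of the forms. -/
def degPiece {A : Type v} [CommRing A] (I : Ideal (MvPolynomial (Fin 2) A)) (d : ℕ) :
    Submodule A (Forms A d) :=
  (I.restrictScalars A).comap (Forms A d).subtype

attribute [local instance] MvPolynomial.gradedAlgebra

/-- The `A`-points of the Hilbert scheme `(ℙ¹)^{[k]}`: homogeneous ideals `I` of `A[x, y]`, all of
whose quotients `A[x, y]_d / I_d` are locally free of rank `hilbFun k d`. This is the functor of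
points of the (Haiman-Sturmfels) Hilbert scheme with this Hilbert function. Closed (open, locally
closed) subschemes are described below by their sets of `A`-points, for all algebras `A` over the
base field. -/
structure HilbPoint (k : ℕ) (A : Type v) [CommRing A] where
  /-- the homogeneous ideal -/
  ideal : Ideal (MvPolynomial (Fin 2) A)
  homogeneous : ideal.IsHomogeneous (MvPolynomial.homogeneousSubmodule (Fin 2) A)
  projective : ∀ d, Module.Projective A (Forms A d ⧸ degPiece ideal d)
  rank : ∀ d (p : PrimeSpectrum A),
    Module.rankAtStalk (Forms A d ⧸ degPiece ideal d) p = hilbFun k d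

namespace HilbPoint

variable {k : ℕ} {A : Type v} [CommRing A]

/-- The degree `d` piece `I_d`. -/
abbrev piece (I : HilbPoint k A) (d : ℕ) : Submodule A (Forms A d) := degPiece I.ideal d

/-- The degree `d` piece `Q_d = A[x, y]_d / I_d` of the universal quotient. -/
abbrev QuotPiece (I : HilbPoint k A) (d : ℕ) : Type v := Forms A d ⧸ I.piece d

/-- The section `σ_U` of `⋀^ℓ Q_d`, `ℓ = |U|`: the wedge of the classes of the monomials in `U`,
in increasing order of `y`-exponents. -/
def wedge (I : HilbPoint k A) {d : ℕ} (U : Finset (Fin (d + 1))) : ⋀[A]^U.card (I.QuotPiece d) :=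
  exteriorPower.ιMulti A U.card
    fun i : Fin U.card => (I.piece d).mkQ (mono A d (U.orderEmbOfFin rfl i))

end HilbPoint

/-- The dependence scheme `D(U)` of a set `U` of monomials of degree `d`, that is, the zero scheme
of `σ_U`, on `A`-points. -/
def dependenceScheme (k : ℕ) {d : ℕ} (U : Finset (Fin (d + 1))) (A : Type v) [CommRing A] :
    Set (HilbPoint k A) :=
  {I | I.wedge U = 0}

/-- The open complement of `D(U)`, on `A`-points: `σ_U` is nonzero at every point of `Spec A`. -/
def dependenceCompl (k : ℕ) {d : ℕ} (U : Finset (Fin (d + 1))) (A : Type v) [CommRing A] :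
    Set (HilbPoint k A) :=
  {I | ∀ p : PrimeSpectrum A, (1 : p.asIdeal.ResidueField) ⊗ₜ[A] I.wedge U ≠ 0}

/-! ### Tropicalization and the matroid stratification -/

/-- The rank function of the matroid `Trop(I_d)` of a homogeneous ideal `I` of `K[x, y]`:
`r(S) = dim (K^S / (I_d ∩ K^S))`, for a set `S` of monomials of degree `d`. -/
def tropRank {k : ℕ} {K : Type w} [Field K] (J : HilbPoint k K) (d : ℕ)
    (S : Finset (Fin (d + 1))) : ℕ :=
  Module.finrank K
    ((S → K) ⧸ (J.piece d).comap (Fintype.linearCombination K fun s : S => mono K d s))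

/-- The stratum of a sequence `r` of rank functions of matroids on the monomials of degree `d`, on
`A`-points: the intersection of the `D(U)` with `U` dependent (`r U < |U|`) and of the complements
of the `D(U)` with `U` independent. -/
def matroidStratum (k : ℕ) (r : (d : ℕ) → Finset (Fin (d + 1)) → ℕ) (A : Type v) [CommRing A] :
    Set (HilbPoint k A) :=
  {I | ∀ (d : ℕ) (U : Finset (Fin (d + 1))),
    (r d U < U.card → I ∈ dependenceScheme k U A) ∧
    (¬ r d U < U.card → I ∈ dependenceCompl k U A)}

/-! ### Symmetric polynomials in the roots -/

/-- The polynomial ring in the coordinates `x_i, y_i` of the `k` roots `[x_i : y_i]`. -/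
abbrev RootRing (k : ℕ) (𝕜 : Type u) [Field 𝕜] : Type u := MvPolynomial (Fin k × Fin 2) 𝕜

/-- The coordinate `x_i` of the `i`-th root. -/
abbrev rx (k : ℕ) (𝕜 : Type u) [Field 𝕜] (i : Fin k) : RootRing k 𝕜 := MvPolynomial.X (i, 0)

/-- The coordinate `y_i` of the `i`-th root. -/
abbrev ry (k : ℕ) (𝕜 : Type u) [Field 𝕜] (i : Fin k) : RootRing k 𝕜 := MvPolynomial.X (i, 1)

/-- The form `∏ i, (y_i x - x_i y)` with roots `[x_i : y_i]`. -/
def rootForm (k : ℕ) (𝕜 : Type u) [Field 𝕜] : MvPolynomial (Fin 2) (RootRing k 𝕜) :=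
  ∏ i : Fin k, (MvPolynomial.C (ry k 𝕜 i) * MvPolynomial.X 0 -
    MvPolynomial.C (rx k 𝕜 i) * MvPolynomial.X 1)

/-- The value `F(a_0, …, a_k)` of a polynomial `F` at the coefficients of a form
`f = a_0 x ^ k + a_1 x ^ (k - 1) y + ⋯ + a_k y ^ k`. -/
def evalCoeffs {k : ℕ} {𝕜 : Type u} [Field 𝕜] {A : Type v} [CommRing A] [Algebra 𝕜 A]
    (F : MvPolynomial (Fin (k + 1)) 𝕜) (f : MvPolynomial (Fin 2) A) : A :=
  MvPolynomial.aeval (fun j : Fin (k + 1) => f.coeff (expo k j)) F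

/-- Under `(ℙ¹)^{[k]} ≅ ℙ^k ≅ Sym^k ℙ¹`, the ideal of the form with coefficients `a_0, …, a_k`
corresponds to its set of roots. `F`, a form of degree `n` in `a_0, …, a_k`, that is, a
section of `O(n)` on `ℙ^k`, corresponds to the symmetric polynomial `G` in the roots. -/
def Corresponds {k : ℕ} {𝕜 : Type u} [Field 𝕜] (n : ℕ) (F : MvPolynomial (Fin (k + 1)) 𝕜)
    (G : RootRing k 𝕜) : Prop :=
  F.IsHomogeneous n ∧ evalCoeffs F (rootForm k 𝕜) = G

/-- The zero scheme in `(ℙ¹)^{[k]} ≅ Sym^k ℙ¹` of the section of `O(n)` given by the symmetric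
polynomial `G`, homogeneous of degree `n` in each pair `x_i, y_i`; on `A`-points. The fibre of
`O(-1)` at `I` is the invertible module `I_k`. -/
def vanishingScheme {k : ℕ} {𝕜 : Type u} [Field 𝕜] (n : ℕ) (G : RootRing k 𝕜)
    (A : Type v) [CommRing A] [Algebra 𝕜 A] : Set (HilbPoint k A) :=
  {I | ∃ F : MvPolynomial (Fin (k + 1)) 𝕜, Corresponds n F G ∧
    ∀ f ∈ I.piece k, evalCoeffs F (f : MvPolynomial (Fin 2) A) = 0}

/-- The open complement of the zero scheme of `G`, on `A`-points: the section is nonzero at every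
point of `Spec A`. -/
def vanishingCompl {k : ℕ} {𝕜 : Type u} [Field 𝕜] (n : ℕ) (G : RootRing k 𝕜)
    (A : Type v) [CommRing A] [Algebra 𝕜 A] : Set (HilbPoint k A) :=
  {I | ∃ F : MvPolynomial (Fin (k + 1)) 𝕜, Corresponds n F G ∧
    ∀ p : PrimeSpectrum A,
      ∃ f ∈ I.piece k, evalCoeffs F (f : MvPolynomial (Fin 2) A) ∉ p.asIdeal}

/-- The cell through the `K`-point `J` of the stratification generated by a set `𝒢` of pairs
`(n, G)` of a degree and a symmetric polynomial, on `A`-points: the intersection of the zero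
schemes of the `G` that vanish at `J` and of the complements of the zero schemes of the others. -/
def generatedStratum {k : ℕ} {𝕜 : Type u} [Field 𝕜] (𝒢 : Set (ℕ × RootRing k 𝕜))
    {K : Type w} [Field K] [Algebra 𝕜 K] (J : HilbPoint k K)
    (A : Type v) [CommRing A] [Algebra 𝕜 A] : Set (HilbPoint k A) :=
  {I | ∀ g ∈ 𝒢,
    (J ∈ vanishingScheme g.1 g.2 K → I ∈ vanishingScheme g.1 g.2 A) ∧
    (J ∉ vanishingScheme g.1 g.2 K → I ∈ vanishingCompl g.1 g.2 A)}

/-- The bihomogeneous elementary symmetric polynomial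
`e_j = ∑_{|S| = j} ∏_{i ∈ S} x_i ∏_{i ∉ S} y_i`. -/
def elem (k : ℕ) (𝕜 : Type u) [Field 𝕜] (j : ℕ) : RootRing k 𝕜 :=
  ∑ S ∈ Finset.powersetCard j (Finset.univ : Finset (Fin k)),
    (∏ i ∈ S, rx k 𝕜 i) * ∏ i ∈ Sᶜ, ry k 𝕜 i

/-- The alternant `a_l = det (x_j ^ l_i * y_j ^ (l_1 - l_i))`, for a decreasing sequence `l`
(with entries indexed from `0`). -/
def alternant (k : ℕ) [NeZero k] (𝕜 : Type u) [Field 𝕜] (l : Fin k → ℕ) : RootRing k 𝕜 :=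
  Matrix.det (Matrix.of fun i j : Fin k => rx k 𝕜 j ^ l i * ry k 𝕜 j ^ (l 0 - l i))

/-- The sequence `(λ_1 + k - 1, λ_2 + k - 2, …, λ_k + 0)`. -/
def shifted {k : ℕ} (lam : Fin k → ℕ) (i : Fin k) : ℕ := lam i + (k - 1 - i)

theorem alternant_zero (k : ℕ) [NeZero k] (𝕜 : Type u) [Field 𝕜] :
    alternant k 𝕜 (shifted 0) =
      ∏ i : Fin k, ∏ j ∈ Finset.Ioi i, (ry k 𝕜 j * rx k 𝕜 i - ry k 𝕜 i * rx k 𝕜 j) := by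
  rw [← Matrix.det_projVandermonde, ← Matrix.det_transpose, alternant]
  congr 1
  ext1 i j
  simp only [Matrix.of_apply, Matrix.transpose_apply, Matrix.projVandermonde_apply, shifted,
    Pi.zero_apply, zero_add, Fin.val_rev, Fin.val_zero]
  have := i.isLt
  rw [mul_comm]
  congr 2 <;> omega

theorem root_relation_irreducible (k : ℕ) (𝕜 : Type u) [Field 𝕜] {i j : Fin k} (hij : i ≠ j) :
    Irreducible (ry k 𝕜 j * rx k 𝕜 i - ry k 𝕜 i * rx k 𝕜 j) := by
  classical
  have hx : ∀ a : Fin k × Fin 2, Irreducible (MvPolynomial.X a : RootRing k 𝕜) := fun a =>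
    MvPolynomial.X_prime.irreducible
  have key : IsRelPrime (ry k 𝕜 j) (-(ry k 𝕜 i * rx k 𝕜 j)) := by
    rw [IsRelPrime.neg_right_iff]
    refine IsRelPrime.mul_right ?_ ?_
    · rw [(hx _).isRelPrime_iff_not_dvd, MvPolynomial.X_dvd_X]
      simp [hij.symm]
    · rw [(hx _).isRelPrime_iff_not_dvd, MvPolynomial.X_dvd_X]
      simp
  have := MvPolynomial.irreducible_mul_X_add (ry k 𝕜 j) (-(ry k 𝕜 i * rx k 𝕜 j)) (i, 0)
    (MvPolynomial.X_ne_zero _) (by simp [MvPolynomial.vars_X])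
    (by
      rw [MvPolynomial.vars_neg]
      intro h
      have := MvPolynomial.vars_mul _ _ h
      simp [MvPolynomial.vars_X, hij] at this) key
  simpa [sub_eq_add_neg] using this

theorem root_relation_dvd (k : ℕ) [NeZero k] (𝕜 : Type u) [Field 𝕜] (l : Fin k → ℕ)
    (hl : ∀ i, l i ≤ l 0) {i j : Fin k} (hij : i ≠ j) :
    ry k 𝕜 j * rx k 𝕜 i - ry k 𝕜 i * rx k 𝕜 j ∣ alternant k 𝕜 l := by
  classical
  have hirr := root_relation_irreducible k 𝕜 hij
  have hp := hirr.prime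
  set p := ry k 𝕜 j * rx k 𝕜 i - ry k 𝕜 i * rx k 𝕜 j with hpdef
  have hy : ¬ p ∣ ry k 𝕜 j ^ l 0 := by
    intro h
    have h1 := map_dvd (MvPolynomial.aeval (fun _ => 1 : Fin k × Fin 2 → 𝕜)) (hp.dvd_of_dvd_pow h)
    simp [hpdef] at h1
  refine (hp.dvd_or_dvd (a := ry k 𝕜 j ^ l 0) ?_).resolve_left hy
  rw [← Ideal.Quotient.eq_zero_iff_dvd, alternant]
  set φ := Ideal.Quotient.mk (Ideal.span {p})
  have hφ : φ (rx k 𝕜 i) * φ (ry k 𝕜 j) = φ (rx k 𝕜 j) * φ (ry k 𝕜 i) := by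
    rw [← map_mul, ← map_mul, Ideal.Quotient.mk_eq_mk_iff_sub_mem]
    exact Ideal.mem_span_singleton.2 ⟨1, by rw [hpdef]; ring⟩
  set M : Matrix (Fin k) (Fin k) (RootRing k 𝕜 ⧸ Ideal.span {p}) :=
    Matrix.of fun a b => φ (rx k 𝕜 b) ^ l a * φ (ry k 𝕜 b) ^ (l 0 - l a) with hM
  have hdet : φ (Matrix.of fun a b => rx k 𝕜 b ^ l a * ry k 𝕜 b ^ (l 0 - l a)).det = M.det := by
    rw [RingHom.map_det]
    congr 1
  have hcol : φ (ry k 𝕜 j ^ l 0) • (fun a => M a i) = φ (ry k 𝕜 i ^ l 0) • (fun a => M a j) := by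
    ext a
    simp only [hM, Matrix.of_apply, Pi.smul_apply, smul_eq_mul, map_pow]
    obtain ⟨c, hc⟩ := Nat.exists_eq_add_of_le (hl a)
    rw [hc, Nat.add_sub_cancel_left]
    calc _ = (φ (rx k 𝕜 i) * φ (ry k 𝕜 j)) ^ l a * (φ (ry k 𝕜 i) * φ (ry k 𝕜 j)) ^ c := by ring
      _ = _ := by rw [hφ]; ring
  rw [map_mul, hdet]
  have hself : M = M.updateCol i (fun a => M a i) := by simp
  rw [hself, ← Matrix.det_updateCol_smul, hcol, Matrix.det_updateCol_smul,
    Matrix.det_updateCol_eq_zero hij.symm, mul_zero]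

theorem alternant_dvd (k : ℕ) [NeZero k] (𝕜 : Type u) [Field 𝕜] (l : Fin k → ℕ)
    (hl : ∀ i, l i ≤ l 0) : alternant k 𝕜 (shifted 0) ∣ alternant k 𝕜 l := by
  classical
  rw [alternant_zero, Finset.prod_sigma']
  refine Finset.prod_dvd_of_isRelPrime ?_ ?_
  · rintro ⟨i, j⟩ h ⟨i', j'⟩ h' hne
    simp only [Finset.coe_sigma, Set.mem_sigma_iff, Finset.coe_univ, Set.mem_univ, true_and,
      Finset.coe_Ioi, Set.mem_Ioi] at h h'
    have hi := root_relation_irreducible k 𝕜 h.ne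
    refine (hi.isRelPrime_iff_not_dvd).2 fun hd => ?_
    obtain ⟨m, hm, hm'⟩ : ∃ m, (m = i' ∨ m = j') ∧ m ≠ i ∧ m ≠ j := by
      by_contra! hcon
      have h1 := hcon i' (Or.inl rfl)
      have h2 := hcon j' (Or.inr rfl)
      apply hne
      by_cases hii : i' = i
      · subst hii
        rw [h2 h'.ne']
      · have h3 := h1 hii
        subst h3
        by_cases hji : j' = i
        · subst hji
          exact absurd (h.trans h') (lt_irrefl _)
        · exact absurd (h2 hji) h'.ne'
    have h1 := map_dvd (MvPolynomial.aeval (fun a : Fin k × Fin 2 =>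
      if a.1 = m then (if a.2 = 0 then 0 else 1) else (if a.2 = 0 then (1 : 𝕜) else 0))) hd
    rcases hm with rfl | rfl
    · simp [hm'.1.symm, hm'.2.symm, h'.ne'] at h1
    · simp [hm'.1.symm, hm'.2.symm, h'.ne] at h1
  · rintro ⟨i, j⟩ h
    simp only [Finset.mem_sigma, Finset.mem_univ, Finset.mem_Ioi, true_and] at h
    exact root_relation_dvd k 𝕜 l hl h.ne

theorem alternant_zero_ne_zero (k : ℕ) [NeZero k] (𝕜 : Type u) [Field 𝕜] :
    alternant k 𝕜 (shifted 0) ≠ 0 := by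
  rw [alternant_zero]
  refine Finset.prod_ne_zero_iff.2 fun i _ => Finset.prod_ne_zero_iff.2 fun j hj => ?_
  exact (root_relation_irreducible k 𝕜 (Finset.mem_Ioi.1 hj).ne).ne_zero

theorem shifted_le {k : ℕ} [NeZero k] {lam : Fin k → ℕ} (hlam : Antitone lam) (i : Fin k) :
    shifted lam i ≤ shifted lam 0 := by
  have := hlam (Fin.zero_le i)
  simp only [shifted, Fin.val_zero]
  omega

/-- The bihomogeneous Schur polynomial `s_λ` in `k` variables of the partition
`λ = (lam 0 ≥ lam 1 ≥ ⋯ ≥ lam (k - 1) ≥ 0)`: the quotient of the alternant of `shifted lam` by the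
alternant of `(k - 1, k - 2, …, 0)`. -/
def schur (k : ℕ) [NeZero k] (𝕜 : Type u) [Field 𝕜] (lam : Fin k → ℕ) (hlam : Antitone lam) :
    RootRing k 𝕜 :=
  (alternant_dvd k 𝕜 (shifted lam) (shifted_le hlam)).choose

theorem schur_spec (k : ℕ) [NeZero k] (𝕜 : Type u) [Field 𝕜] (lam : Fin k → ℕ)
    (hlam : Antitone lam) :
    alternant k 𝕜 (shifted lam) = alternant k 𝕜 (shifted 0) * schur k 𝕜 lam hlam :=
  (alternant_dvd k 𝕜 (shifted lam) (shifted_le hlam)).choose_spec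

/-- The pairs `(1, e_0)` and `(λ_1, s_λ)`, for all partitions `λ` with at most `k` parts. -/
def schurFamily (k : ℕ) [NeZero k] (𝕜 : Type u) [Field 𝕜] : Set (ℕ × RootRing k 𝕜) :=
  {g | g = (1, elem k 𝕜 0) ∨
    ∃ (lam : Fin k → ℕ) (hlam : Antitone lam), g = (lam 0, schur k 𝕜 lam hlam)}

/-! ### Rim paths and monomial sets -/

/-- One step along the rim of the Young diagram of `lam`, whose row number `b` occupies the
columns from `0` to `lam b`, between the heights `-b` and `-(b + 1)`. The pair `(a, b)` stands for
the lattice point `(a, -b)`. The step is downwards if it follows the right end of row `b`, and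
to the left otherwise. -/
def rimStep {k : ℕ} (lam : Fin k → ℕ) (P : ℕ × ℕ) : ℕ × ℕ :=
  if ∃ hb : P.2 < k, lam ⟨P.2, hb⟩ = P.1 then (P.1, P.2 + 1) else (P.1 - 1, P.2)

/-- The rim path of `lam`, from `(h, 0)` to `(0, -k)`: the lattice point at which step `i`
starts. -/
def rimPath {k : ℕ} (h : ℕ) (lam : Fin k → ℕ) (i : ℕ) : ℕ × ℕ := (rimStep lam)^[i] (h, 0)

/-- The monomial set of `lam`: the monomials `x ^ (h + k - 1 - i) * y ^ i` with `0 ≤ i ≤ h + k - 1`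
such that step `i` of the rim path is vertical. -/
def monomialSet {k : ℕ} (h : ℕ) (lam : Fin k → ℕ) : Finset (Fin (h + k - 1 + 1)) :=
  Finset.univ.filter fun i => (rimPath h lam (i + 1)).2 = (rimPath h lam i).2 + 1

end HilbP1

end

noncomputable section

namespace HilbP1

attribute [local instance] MvPolynomial.gradedAlgebra

/-! ### Local arguments without localizing -/

section Local

variable {A : Type*} [CommRing A]

/-! Part (1). Write `d = h + k - 1`. Locally `I_k` is generated by one form `f` that is nonzero at
every point, and the `h` products of `f` with the monomials of degree `h - 1` span the kernel of
`A[x, y]_d → Q_d`. So the wedge of `k` monomials in the invertible module `⋀^k Q_d` vanishes exactly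
when the determinant of these monomials together with the multiples of `f` vanishes. This
determinant is a polynomial `detPoly` of degree `h` in the coefficients of `f`. To express it in the
roots, multiply its matrix by the matrix evaluating forms at the `k` roots, completed by an identity
block. The multiples of `f` evaluate to zero, so the product is block triangular, and comparing
determinants gives `e_0 ^ h * a_δ * detPoly = e_0 ^ (h - λ_1) * a_{λ+δ} * e_0 ^ h`, where `δ = (k -
1, …, 0)`. Cancelling leaves `e_0 ^ (h - λ_1) * s_λ` (`corresponds_detPoly`).

The reduction to determinants works over an arbitrary ring without choosing local bases of `Q_d`:
Cramer's rule expands everything in terms of some monomials `w` and multiples of a form in `I_k`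
whose determinant `δ` is outside a given prime, and powers of `δ` are cleared at the end
(`wedge_eq_zero_iff_det`, `residue_wedge_ne_zero_iff_det`).

Part (2). Below degree `k` the ideal is zero, so all sets of monomials are independent. In degree `d
≥ k` every `k`-element set is some `U_λ` (`exists_partition`). Smaller sets are controlled by their
completions to `k` elements, and larger ones are always dependent (`wedge_eq_zero_of_append`). Hence
the matroid stratum is cut out by the products `e_0 ^ (h - λ_1) * s_λ`. These give back the factors,
through `h = 1`, `λ = 0` and through `h = λ_1`; conversely the factors determine the conditions on
the products, since one local generator of `I_k` tests all sections at a prime. -/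

theorem eq_zero_of_locally {P : Type*} [AddCommGroup P] [Module A P] (x : P)
    (h : ∀ p : PrimeSpectrum A, ∃ t ∉ p.asIdeal, t • x = 0) : x = 0 := by
  have htop : Ideal.torsionOf A P x = ⊤ := by
    by_contra hne
    obtain ⟨m, hm, hle⟩ := Ideal.exists_le_maximal _ hne
    obtain ⟨t, ht, htx⟩ := h ⟨m, hm.isPrime⟩
    exact ht (hle ((Ideal.mem_torsionOf_iff x t).2 htx))
  have : (1 : A) ∈ Ideal.torsionOf A P x := htop ▸ Submodule.mem_top
  simpa using (Ideal.mem_torsionOf_iff x 1).1 this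

theorem residue_tmul_ne_zero {P : Type*} [AddCommGroup P] [Module A P] (p : PrimeSpectrum A)
    (g : P →ₗ[A] A) {x : P} (hx : g x ∉ p.asIdeal) :
    (1 : p.asIdeal.ResidueField) ⊗ₜ[A] x ≠ 0 := by
  intro h0
  apply hx
  have h1 := congrArg (fun y => TensorProduct.rid A p.asIdeal.ResidueField
    (LinearMap.lTensor p.asIdeal.ResidueField g y)) h0
  simp only [LinearMap.lTensor_tmul, TensorProduct.rid_tmul, map_zero] at h1
  rw [Algebra.smul_def, mul_one] at h1
  exact Ideal.algebraMap_residueField_eq_zero.1 h1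

theorem residue_tmul_smul_eq_zero {P : Type*} [AddCommGroup P] [Module A P] (p : PrimeSpectrum A)
    {a : A} (ha : a ∈ p.asIdeal) (x : P) :
    (1 : p.asIdeal.ResidueField) ⊗ₜ[A] (a • x) = 0 := by
  rw [← TensorProduct.smul_tmul, Algebra.smul_def, mul_one,
    Ideal.algebraMap_residueField_eq_zero.2 ha, TensorProduct.zero_tmul]

theorem residue_tmul_eq_zero_of_smul {P : Type*} [AddCommGroup P] [Module A P]
    (p : PrimeSpectrum A) {a : A} (ha : a ∉ p.asIdeal) {x : P}
    (h : (1 : p.asIdeal.ResidueField) ⊗ₜ[A] (a • x) = 0) :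
    (1 : p.asIdeal.ResidueField) ⊗ₜ[A] x = 0 := by
  have hne : algebraMap A p.asIdeal.ResidueField a ≠ 0 :=
    fun h => ha (Ideal.algebraMap_residueField_eq_zero.1 h)
  rw [TensorProduct.tmul_smul, ← algebraMap_smul p.asIdeal.ResidueField a] at h
  exact (smul_eq_zero.1 h).resolve_left hne

/-- Elements spanning a projective module of rank `r` at a prime, `r` in number, satisfy only
relations that vanish there. -/
theorem exists_mul_coeff_eq_zero {Q : Type*} [AddCommGroup Q] [Module A Q] [Module.Finite A Q]
    [Module.Projective A Q] (p : PrimeSpectrum A) {ι : Type*} [Fintype ι]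
    (hr : Module.rankAtStalk Q p = Fintype.card ι) (q : ι → Q) {δ : A} (hδ : δ ∉ p.asIdeal)
    (hspan : ∀ x : Q, δ • x ∈ Submodule.span A (Set.range q)) (c : ι → A)
    (hc : ∑ i, c i • q i = 0) : ∃ t ∉ p.asIdeal, ∀ i, t * c i = 0 := by
  classical
  set S := p.asIdeal.primeCompl
  set B := Localization.AtPrime p.asIdeal
  let f := LocalizedModule.mkLinearMap S Q
  -- Over the local ring the module is free of rank `|ι|`, so `|ι|` spanning elements are
  -- independent.
  have hli : LinearIndependent B (fun i => f (q i)) := by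
    refine linearIndependent_of_top_le_span_of_card_eq_finrank ?_ hr.symm
    intro y _
    obtain ⟨⟨x, s⟩, hxs⟩ := IsLocalizedModule.surj S f y
    have hmem : ∀ z ∈ Submodule.span A (Set.range q),
        f z ∈ Submodule.span B (Set.range fun i => f (q i)) := by
      intro z hz
      induction hz using Submodule.span_induction with
      | mem x hx =>
        obtain ⟨i, rfl⟩ := hx
        exact Submodule.subset_span ⟨i, rfl⟩
      | zero => simp
      | add x y _ _ hx hy => rw [map_add]; exact add_mem hx hy
      | smul a x _ hx =>
        rw [map_smul, ← algebraMap_smul B a]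
        exact Submodule.smul_mem _ _ hx
    have h1 := hmem _ (hspan x)
    have hu : IsUnit (algebraMap A B (δ * s)) :=
      IsLocalization.map_units B (⟨δ * s, S.mul_mem hδ s.2⟩ : S)
    obtain ⟨u, hu⟩ := hu
    have h2 : (u : B) • y = f (δ • x) := by
      rw [hu, algebraMap_smul, mul_smul, map_smul, ← hxs]
      rfl
    rw [← h2] at h1
    have h3 := Submodule.smul_mem _ (↑u⁻¹ : B) h1
    rwa [smul_smul, Units.inv_mul, one_smul] at h3
  have h0 : ∑ i, algebraMap A B (c i) • f (q i) = 0 := by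
    have := congrArg f hc
    rw [map_sum, map_zero] at this
    rw [← this]
    refine Finset.sum_congr rfl fun i _ => ?_
    rw [algebraMap_smul, map_smul]
  have h1 := Fintype.linearIndependent_iff.1 hli _ h0
  have h2 : ∀ i, ∃ t : S, (t : A) * c i = 0 := fun i =>
    (IsLocalization.map_eq_zero_iff S B (c i)).1 (h1 i)
  choose t ht using h2
  -- Each coefficient dies in the localization, hence is killed by some `t i` outside `p`; the
  -- product kills all of them.
  refine ⟨∏ i, (t i : A), ?_, fun i => ?_⟩
  · have : ∏ i, (t i : A) ∈ S := S.prod_mem fun i _ => (t i).2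
    exact this
  · rw [← Finset.prod_erase_mul _ _ (Finset.mem_univ i), mul_assoc, ht, mul_zero]

/-- A module mapping onto a spanning set of `κ(p) ^ ι` has rank at least `|ι|` at `p`. -/
theorem card_le_rankAtStalk {Q : Type*} [AddCommGroup Q] [Module A Q] [Module.Finite A Q]
    [Module.Projective A Q] (p : PrimeSpectrum A) {ι : Type*} [Fintype ι]
    (g : Q →ₗ[A] (ι → p.asIdeal.ResidueField))
    (hg : Submodule.span p.asIdeal.ResidueField (Set.range g) = ⊤) :
    Fintype.card ι ≤ Module.rankAtStalk Q p := by
  rw [Module.rankAtStalk_eq]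
  let G : p.asIdeal.Fiber Q →ₗ[p.asIdeal.ResidueField] (ι → p.asIdeal.ResidueField) :=
    LinearMap.liftBaseChange p.asIdeal.ResidueField g
  have hG : Function.Surjective G := by
    rw [← LinearMap.range_eq_top, eq_top_iff, ← hg, Submodule.span_le]
    rintro _ ⟨x, rfl⟩
    exact ⟨1 ⊗ₜ x, by simp [G]⟩
  simpa using LinearMap.finrank_le_finrank_of_surjective hG

end Local

/-! ### Determinants with some fixed entries -/

section Det

variable {A : Type*} [CommRing A] {M : Type*} [AddCommGroup M] [Module A M]
  {P : Type*} [AddCommGroup P] [Module A P]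

/-- The alternating map in the left entries obtained by fixing the right entries. -/
def fixRight {ι κ : Type*} (g : M [⋀^ι ⊕ κ]→ₗ[A] P) (n : κ → M) : M [⋀^ι]→ₗ[A] P where
  toFun v := g (Sum.elim v n)
  map_update_add' v i x y := by
    classical
    simp only [Sum.update_elim_inl.symm]
    convert g.map_update_add (Sum.elim v n) (Sum.inl i) x y using 2
  map_update_smul' v i c x := by
    classical
    convert g.map_update_smul (Sum.elim v n) (Sum.inl i) c x using 2 <;>
      (try rw [← Sum.update_elim_inl]; try congr!)
  map_eq_zero_of_eq' v i j h hij :=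
    g.map_eq_zero_of_eq _ (i := Sum.inl i) (j := Sum.inl j) (by simpa using h) (by simpa using hij)

@[simp]
theorem fixRight_apply {ι κ : Type*} (g : M [⋀^ι ⊕ κ]→ₗ[A] P) (n : κ → M) (v : ι → M) :
    fixRight g n v = g (Sum.elim v n) := rfl

/-- Pulled back to `A ^ ι`, an alternating map in `|ι|` arguments is a multiple of the determinant,
because it is determined by its value on the standard basis. -/
theorem alternating_sum_smul {ι : Type*} [Fintype ι] [DecidableEq ι] (g : M [⋀^ι]→ₗ[A] P)
    (C : Matrix ι ι A) (q : ι → M) :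
    g (fun b => ∑ c, C c b • q c) = C.det • g q := by
  let b := Pi.basisFun A ι
  let L : (ι → A) →ₗ[A] M := Fintype.linearCombination A q
  have key : g.compLinearMap L = (LinearMap.toSpanSingleton A P (g q)).compAlternatingMap b.det := by
    refine b.ext_alternating fun v hv => ?_
    let σ := Equiv.ofBijective v (Finite.injective_iff_bijective.1 hv)
    have h1 : (fun i => b (v i)) = b ∘ σ := rfl
    rw [h1, AlternatingMap.map_perm, AlternatingMap.map_perm]
    congr 1
    simp only [AlternatingMap.compLinearMap_apply, LinearMap.compAlternatingMap_apply, b.det_self,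
      LinearMap.toSpanSingleton_apply, one_smul]
    congr 1
    funext i
    simp [L, b, Fintype.linearCombination_apply]
  have h := DFunLike.congr_fun key (fun b c => C c b)
  simp only [AlternatingMap.compLinearMap_apply, LinearMap.compAlternatingMap_apply,
      LinearMap.toSpanSingleton_apply, L, Fintype.linearCombination_apply] at h
  rw [h, Module.Basis.det_apply]
  congr 2

variable {J : Type*} [Fintype J] [DecidableEq J]

/-- Cramer's rule, free of division: `d` need not be a basis. -/
theorem det_smul_eq_sum (e : Module.Basis J A M) (d : J → M) (x : M) :
    e.det d • x = ∑ s, e.det (Function.update d s x) • d s := by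
  apply e.repr.injective
  ext i
  have h := congrFun (Matrix.mulVec_cramer (e.toMatrix d) (e.repr x)) i
  simp only [Matrix.mulVec, dotProduct, Matrix.cramer_apply, Pi.smul_apply, smul_eq_mul] at h
  simp only [map_smul, map_sum, Finsupp.smul_apply, smul_eq_mul, Module.Basis.det_apply,
    Finsupp.coe_finsetSum, Finset.sum_apply, Module.Basis.toMatrix_update, ← h]
  refine Finset.sum_congr rfl fun s _ => ?_
  rw [mul_comm]
  rfl

/-- Scale every entry of `v` by `e.det d` and expand it by Cramer's rule. The matrix on the right
has visible block structure when `v` and `d` share entries or when entries come from a submodule. -/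
theorem det_pow_mul_det (e : Module.Basis J A M) (d v : J → M) :
    e.det d ^ Fintype.card J * e.det v =
      e.det d * (Matrix.of fun s r => e.det (Function.update d s (v r))).det := by
  have h := alternating_sum_smul e.det
    (Matrix.of fun s r => e.det (Function.update d s (v r))) d
  simp only [Matrix.of_apply, ← det_smul_eq_sum] at h
  rw [← smul_eq_mul, ← smul_eq_mul]
  rw [show (fun b => e.det d • v b) = fun b => (fun _ : J => e.det d) b • v b from rfl,
    AlternatingMap.map_smul_univ] at h
  simpa [mul_comm] using h

theorem update_self_entry (e : Module.Basis J A M) (d : J → M) (s r : J) :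
    e.det (Function.update d s (d r)) = if s = r then e.det d else 0 := by
  split_ifs with h
  · subst h; simp
  · exact e.det.map_update_self d h

/-- Pigeonhole: a permutation cannot send the `|κ| + 1` columns `inl b` and `inr i` injectively into
the `|κ|` lower rows, so each term of the determinant has a factor killed by `t`. -/
theorem smul_det_eq_zero_of_block {ι κ : Type*} [Fintype ι] [DecidableEq ι] [Fintype κ]
    [DecidableEq κ] (X : Matrix (ι ⊕ κ) (ι ⊕ κ) A) (b : ι) (t : A)
    (hb : ∀ s, t * X (Sum.inl s) (Sum.inl b) = 0)
    (hκ : ∀ s i, t * X (Sum.inl s) (Sum.inr i) = 0) : t * X.det = 0 := by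
  rw [Matrix.det_apply, Finset.mul_sum]
  refine Finset.sum_eq_zero fun σ _ => ?_
  rw [mul_smul_comm]
  suffices h : ∃ r, t * X (σ r) r = 0 by
    obtain ⟨r, hr⟩ := h
    rw [← Finset.mul_prod_erase _ _ (Finset.mem_univ r), ← mul_assoc, hr, zero_mul, smul_zero]
  let emb : Option κ → ι ⊕ κ := fun o => o.elim (Sum.inl b) Sum.inr
  have hemb : Function.Injective emb := by
    rintro (_ | i) (_ | j) h <;> simp_all [emb]
  by_contra! hne
  have h2 : ∀ o, ∃ i, σ (emb o) = Sum.inr i := by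
    intro o
    rcases hs : σ (emb o) with s | i
    · exfalso
      apply hne (emb o)
      rw [hs]
      rcases o with _ | i
      · exact hb s
      · exact hκ s i
    · exact ⟨i, rfl⟩
  choose φ hφ using h2
  have hinj : Function.Injective φ := by
    intro o o' h
    apply hemb
    apply σ.injective
    rw [hφ, hφ, h]
  have := Fintype.card_le_of_injective φ hinj
  simp at this

end Det

/-! ### Exterior powers of projective quotients of free modules -/

section Quotient

variable {A : Type*} [CommRing A] {M : Type*} [AddCommGroup M] [Module A M] {N : Submodule A M}

/-- A splitting of `M → M ⧸ N` defines the descended map. Replacing the arguments one at a time by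
their images under the splitting changes each by an element of `N`, which does not affect `g`. -/
theorem exists_alternating_quotient [Module.Projective A (M ⧸ N)] {P : Type*} [AddCommGroup P]
    [Module A P] {ι : Type*} [Fintype ι] [DecidableEq ι] (g : M [⋀^ι]→ₗ[A] P)
    (hg : ∀ v b, v b ∈ N → g v = 0) :
    ∃ g' : (M ⧸ N) [⋀^ι]→ₗ[A] P, ∀ v : ι → M, g' (fun b => N.mkQ (v b)) = g v := by
  obtain ⟨s, hs⟩ := Module.projective_lifting_property N.mkQ LinearMap.id N.mkQ_surjective
  refine ⟨g.compLinearMap s, fun v => ?_⟩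
  have hs' : ∀ x, s (N.mkQ x) - x ∈ N := by
    intro x
    refine (Submodule.Quotient.eq N).1 ?_
    exact LinearMap.congr_fun hs (N.mkQ x)
  let v' : ι → M := fun b => s (N.mkQ (v b))
  have key : ∀ T : Finset ι, g (T.piecewise v' v) = g v := by
    intro T
    induction T using Finset.induction_on with
    | empty => simp
    | insert a T ha ih =>
      rw [Finset.piecewise_insert]
      have h1 : v' a = (T.piecewise v' v) a + (v' a - v a) := by
        simp [Finset.piecewise_eq_of_notMem _ _ _ ha]
      have h2 : g (Function.update (T.piecewise v' v) a (v' a - v a)) = 0 :=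
        hg _ a (by rw [Function.update_self]; exact hs' (v a))
      rw [h1, g.map_update_add, Function.update_eq_self, ih, h2, add_zero]
  simpa [v'] using key Finset.univ

variable {ι κ : Type*} [Fintype ι] [DecidableEq ι] [Fintype κ] [DecidableEq κ]

theorem smul_mkQ_eq_sum (e : Module.Basis (ι ⊕ κ) A M) {n : κ → M} (hn : ∀ i, n i ∈ N)
    (w : ι → M) (x : M) :
    e.det (Sum.elim w n) • N.mkQ x =
      ∑ s, e.det (Sum.elim (Function.update w s x) n) • N.mkQ (w s) := by
  have h := congrArg N.mkQ (det_smul_eq_sum e (Sum.elim w n) x)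
  have h0 : ∀ i, N.mkQ (n i) = 0 := fun i => by simpa using hn i
  rw [map_smul, map_sum, Fintype.sum_sum_type] at h
  simpa only [map_smul, Sum.elim_inl, Sum.elim_inr, h0, smul_zero,
    Finset.sum_const_zero, add_zero, Sum.update_elim_inl] using h

/-- If `M / N` has rank `|ι|`, then a determinant with more than `|κ|` entries from `N` is zero. -/
theorem det_eq_zero_of_mem [Module.Projective A (M ⧸ N)] (e : Module.Basis (ι ⊕ κ) A M)
    (hr : ∀ p, Module.rankAtStalk (R := A) (M ⧸ N) p = Fintype.card ι)
    (hgen : ∀ p : PrimeSpectrum A, ∃ n : κ → M, (∀ i, n i ∈ N) ∧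
      ∃ w : ι → M, e.det (Sum.elim w n) ∉ p.asIdeal)
    {n : κ → M} (hn : ∀ i, n i ∈ N) (v : ι → M) (b : ι) (hv : v b ∈ N) :
    e.det (Sum.elim v n) = 0 := by
  have : Module.Finite A M := Module.Finite.of_basis e
  refine eq_zero_of_locally (A := A) _ fun p => ?_
  obtain ⟨n₀, hn₀, w, hδ⟩ := hgen p
  set δ := e.det (Sum.elim w n₀)
  have hspan : ∀ y : M ⧸ N, δ • y ∈ Submodule.span A (Set.range fun s => N.mkQ (w s)) := by
    intro y
    obtain ⟨x, rfl⟩ := N.mkQ_surjective y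
    rw [smul_mkQ_eq_sum e hn₀]
    exact sum_mem fun s _ => Submodule.smul_mem _ _ (Submodule.subset_span ⟨s, rfl⟩)
  -- The Cramer expansion of `x ∈ N` is a relation among the classes of `w`, which are as many as
  -- the rank and span after multiplication by `δ`.
  have hloc : ∀ x ∈ N, ∃ t ∉ p.asIdeal, ∀ s,
      t * e.det (Sum.elim (Function.update w s x) n₀) = 0 := by
    intro x hx
    refine exists_mul_coeff_eq_zero p (hr p) _ hδ hspan _ ?_
    rw [← smul_mkQ_eq_sum e hn₀]
    rw [show N.mkQ x = 0 by simpa using hx, smul_zero]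
  obtain ⟨t, ht, htv⟩ := hloc _ hv
  choose t' ht' htn using fun i => hloc _ (hn i)
  -- The Cramer matrix has `|κ| + 1` columns coming from `N`, and their upper entries are killed
  -- locally.
  have h1 := smul_det_eq_zero_of_block (Matrix.of fun s r =>
    e.det (Function.update (Sum.elim w n₀) s (Sum.elim v n r))) b (t * ∏ i, t' i)
    (fun s => by
      rw [Matrix.of_apply, Sum.update_elim_inl, Sum.elim_inl, mul_right_comm, htv, zero_mul])
    (fun s i => by
      rw [Matrix.of_apply, Sum.update_elim_inl, Sum.elim_inr,
        ← Finset.prod_erase_mul _ _ (Finset.mem_univ i), mul_assoc, mul_assoc, htn, mul_zero,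
        mul_zero])
  refine ⟨(t * ∏ i, t' i) * δ ^ Fintype.card (ι ⊕ κ), ?_, ?_⟩
  · intro hmem
    have hS : (t * ∏ i, t' i) * δ ^ Fintype.card (ι ⊕ κ) ∈ p.asIdeal.primeCompl :=
      mul_mem (mul_mem ht (prod_mem fun i _ => ht' i)) (pow_mem hδ _)
    exact hS hmem
  · rw [smul_eq_mul, mul_assoc, det_pow_mul_det, mul_left_comm, h1, mul_zero]

/-- The expansion of the entries `v` in terms of `w`, modulo `N`. -/
theorem exists_coeff_alternating (e : Module.Basis (ι ⊕ κ) A M) {n : κ → M} (hn : ∀ i, n i ∈ N)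
    (w v : ι → M) : ∃ c : A,
      e.det (Sum.elim w n) ^ Fintype.card (ι ⊕ κ) * e.det (Sum.elim v n) =
        e.det (Sum.elim w n) ^ (Fintype.card κ + 1) * c ∧
      ∀ {P : Type _} [AddCommGroup P] [Module A P] (g : (M ⧸ N) [⋀^ι]→ₗ[A] P),
        e.det (Sum.elim w n) ^ Fintype.card ι • g (fun b => N.mkQ (v b)) =
          c • g (fun b => N.mkQ (w b)) := by
  -- The coefficient is the determinant of the Cramer coordinates of `v` along `w`. The columns of
  -- `n` in the full Cramer matrix are `e.det (Sum.elim w n)` times unit vectors, since `n` is part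
  -- of the reference family.
  refine ⟨(Matrix.of fun s b => e.det (Sum.elim (Function.update w s (v b)) n)).det, ?_, ?_⟩
  · rw [det_pow_mul_det]
    have : (Matrix.of fun s r => e.det (Function.update (Sum.elim w n) s (Sum.elim v n r))) =
        Matrix.fromBlocks (Matrix.of fun s b => e.det (Sum.elim (Function.update w s (v b)) n)) 0
          (Matrix.of fun i b => e.det (Function.update (Sum.elim w n) (Sum.inr i) (v b)))
          (e.det (Sum.elim w n) • (1 : Matrix κ κ A)) := by
      ext (s | i) (r | j)
      · rw [Matrix.of_apply, Sum.update_elim_inl]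
        rfl
      · exact (update_self_entry e (Sum.elim w n) (Sum.inl s) (Sum.inr j)).trans
          (if_neg Sum.inl_ne_inr)
      · rfl
      · refine (update_self_entry e (Sum.elim w n) (Sum.inr i) (Sum.inr j)).trans ?_
        rw [Matrix.fromBlocks_apply₂₂, Matrix.smul_apply, Matrix.one_apply, smul_ite, smul_zero,
          smul_eq_mul, mul_one]
        exact if_congr Sum.inr_injective.eq_iff rfl rfl
    rw [this, Matrix.det_fromBlocks_zero₁₂, Matrix.det_smul, Matrix.det_one]
    ring
  · intro P _ _ g
    rw [← alternating_sum_smul]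
    simp only [Matrix.of_apply, ← smul_mkQ_eq_sum e hn]
    rw [← Finset.card_univ, ← Finset.prod_const]
    exact (g.map_smul_univ (fun _ => e.det (Sum.elim w n)) fun b => N.mkQ (v b)).symm

end Quotient

/-! ### Detecting the vanishing of wedges by determinants of linear forms -/

section Wedge

variable {A : Type*} [CommRing A]

/-- The alternating map `u ↦ det (η_j (u_i))` of a family `η` of linear forms. -/
def detForms {Q : Type*} [AddCommGroup Q] [Module A Q] {ι : Type*} [Fintype ι] [DecidableEq ι]
    (η : ι → Q →ₗ[A] A) : Q [⋀^ι]→ₗ[A] A :=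
  Matrix.detRowAlternating.compLinearMap (LinearMap.pi η)

theorem detForms_apply {Q : Type*} [AddCommGroup Q] [Module A Q] {ι : Type*} [Fintype ι]
    [DecidableEq ι] (η : ι → Q →ₗ[A] A) (u : ι → Q) :
    detForms η u = (Matrix.of fun i j => η j (u i)).det := rfl

theorem apply_eq_zero_of_wedge_eq_zero {Q P : Type*} [AddCommGroup Q] [Module A Q]
    [AddCommGroup P] [Module A P] {m : ℕ} (g : Q [⋀^Fin m]→ₗ[A] P) {u : Fin m → Q}
    (h : exteriorPower.ιMulti A m u = 0) : g u = 0 := by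
  rw [← exteriorPower.alternatingMapLinearEquiv_apply_ιMulti, h, map_zero]

variable {M : Type*} [AddCommGroup M] [Module A M] {N : Submodule A M}

/-- `M ⧸ N` is a direct summand of the free module `M`, and the coordinates of a wedge in the
exterior power of a free module are minors. -/
theorem exists_wedge_eq_sum [Module.Projective A (M ⧸ N)] {J : Type*} [Fintype J]
    (e : Module.Basis J A M) (m : ℕ) :
    ∃ (r : ℕ) (η : Fin r → Fin m → (M ⧸ N) →ₗ[A] A) (z : Fin r → ⋀[A]^m (M ⧸ N)),
      ∀ u : Fin m → M ⧸ N, exteriorPower.ιMulti A m u = ∑ B, detForms (η B) u • z B := by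
  classical
  obtain ⟨s, hs⟩ := Module.projective_lifting_property N.mkQ LinearMap.id N.mkQ_surjective
  let e' : Module.Basis (Fin (Fintype.card J)) A M := e.reindex (Fintype.equivFin J)
  let B := Set.powersetCard (Fin (Fintype.card J)) m
  let eB : B ≃ Fin (Fintype.card B) := Fintype.equivFin B
  refine ⟨Fintype.card B,
    fun b j => (e'.coord (Set.powersetCard.ofFinEmbEquiv.symm (eB.symm b) j)) ∘ₗ s,
    fun b => exteriorPower.map m N.mkQ (e'.exteriorPower m (eB.symm b)), fun u => ?_⟩
  have h1 : exteriorPower.ιMulti A m u =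
      exteriorPower.map m N.mkQ (exteriorPower.ιMulti A m (s ∘ u)) := by
    rw [exteriorPower.map_apply_ιMulti]
    congr 1
    funext i
    exact (LinearMap.congr_fun hs (u i)).symm
  rw [h1, ← (e'.exteriorPower m).sum_repr (exteriorPower.ιMulti A m (s ∘ u)), map_sum,
    ← eB.symm.sum_comp]
  refine Finset.sum_congr rfl fun b _ => ?_
  rw [map_smul, exteriorPower.basis_repr_apply, exteriorPower.ιMultiDual_apply_ιMulti]
  rfl

theorem wedge_eq_zero_of_detForms [Module.Projective A (M ⧸ N)] {J : Type*} [Fintype J]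
    (e : Module.Basis J A M) {m : ℕ} {u : Fin m → M ⧸ N}
    (h : ∀ η : Fin m → (M ⧸ N) →ₗ[A] A, detForms η u = 0) : exteriorPower.ιMulti A m u = 0 := by
  obtain ⟨r, η, z, hz⟩ := exists_wedge_eq_sum (N := N) e m
  rw [hz]
  exact Finset.sum_eq_zero fun B _ => by rw [h, zero_smul]

theorem residue_wedge_ne_zero {Q P : Type*} [AddCommGroup Q] [Module A Q]
    [AddCommGroup P] [Module A P] {m m' : ℕ} (g : Q [⋀^Fin m]→ₗ[A] ⋀[A]^m' P) {u : Fin m → Q}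
    (p : PrimeSpectrum A) (h : (1 : p.asIdeal.ResidueField) ⊗ₜ[A] g u ≠ 0) :
    (1 : p.asIdeal.ResidueField) ⊗ₜ[A] exteriorPower.ιMulti A m u ≠ 0 := by
  intro h0
  apply h
  rw [← exteriorPower.alternatingMapLinearEquiv_apply_ιMulti g, ← LinearMap.lTensor_tmul, h0,
    map_zero]

/-- The alternating map `u ↦ u ∧ z`. -/
def wedgeRight {Q : Type*} [AddCommGroup Q] [Module A Q] {l j : ℕ} (z : Fin j → Q) :
    Q [⋀^Fin l]→ₗ[A] ⋀[A]^(l + j) Q :=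
  fixRight ((exteriorPower.ιMulti A (l + j)).domDomCongr finSumFinEquiv.symm) z

theorem wedgeRight_apply {Q : Type*} [AddCommGroup Q] [Module A Q] {l j : ℕ} (z : Fin j → Q)
    (u : Fin l → Q) :
    wedgeRight (A := A) z u = exteriorPower.ιMulti A (l + j) (Fin.append u z) := by
  rw [wedgeRight, fixRight_apply, AlternatingMap.domDomCongr_apply]
  congr 1
  funext i
  refine Fin.addCases (fun i => ?_) (fun i => ?_) i <;> simp

theorem wedge_append_eq_zero {Q : Type*} [AddCommGroup Q] [Module A Q] {l j : ℕ} (z : Fin j → Q)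
    {u : Fin l → Q} (h : exteriorPower.ιMulti A l u = 0) :
    exteriorPower.ιMulti A (l + j) (Fin.append u z) = 0 := by
  rw [← wedgeRight_apply]
  exact apply_eq_zero_of_wedge_eq_zero _ h

theorem residue_wedge_ne_zero_of_append {Q : Type*} [AddCommGroup Q] [Module A Q] {l j : ℕ}
    (z : Fin j → Q) {u : Fin l → Q} (p : PrimeSpectrum A)
    (h : (1 : p.asIdeal.ResidueField) ⊗ₜ[A]
      exteriorPower.ιMulti A (l + j) (Fin.append u z) ≠ 0) :
    (1 : p.asIdeal.ResidueField) ⊗ₜ[A] exteriorPower.ιMulti A l u ≠ 0 := by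
  rw [← wedgeRight_apply] at h
  exact residue_wedge_ne_zero _ p h

/-! ### Top-degree wedges as determinants, and completion of shorter wedges -/

section TopDegree

variable [Module.Projective A (M ⧸ N)] {k : ℕ} {κ : Type*} [Fintype κ] [DecidableEq κ]

theorem exists_linearMap_wedge (e : Module.Basis (Fin k ⊕ κ) A M)
    (hr : ∀ p, Module.rankAtStalk (R := A) (M ⧸ N) p = k)
    (hgen : ∀ p : PrimeSpectrum A, ∃ n : κ → M, (∀ i, n i ∈ N) ∧
      ∃ w : Fin k → M, e.det (Sum.elim w n) ∉ p.asIdeal)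
    {n : κ → M} (hn : ∀ i, n i ∈ N) : ∃ Φ : ⋀[A]^k (M ⧸ N) →ₗ[A] A, ∀ v : Fin k → M,
      Φ (exteriorPower.ιMulti A k fun b => N.mkQ (v b)) = e.det (Sum.elim v n) := by
  obtain ⟨g, hg⟩ := exists_alternating_quotient (N := N) (fixRight e.det n) fun v b hb =>
    det_eq_zero_of_mem e (by simpa using hr) hgen hn v b hb
  exact ⟨exteriorPower.alternatingMapLinearEquiv g, fun v => by
    rw [exteriorPower.alternatingMapLinearEquiv_apply_ιMulti, hg, fixRight_apply]⟩

/-- The determinants with right entries fixed in `N` descend to linear forms on `⋀^k (M ⧸ N)`.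
Conversely, near a prime where `(w, n)` has invertible determinant, the wedge of `v` is a multiple
of the wedge of `w`, with coefficient `det (v, n)` up to a unit. -/
theorem wedge_eq_zero_iff_det (e : Module.Basis (Fin k ⊕ κ) A M)
    (hr : ∀ p, Module.rankAtStalk (R := A) (M ⧸ N) p = k) (F : Set (κ → M))
    (hF : ∀ n ∈ F, ∀ i, n i ∈ N)
    (hgen : ∀ p : PrimeSpectrum A, ∃ n ∈ F, ∃ w : Fin k → M, e.det (Sum.elim w n) ∉ p.asIdeal)
    (v : Fin k → M) :
    exteriorPower.ιMulti A k (fun b => N.mkQ (v b)) = 0 ↔ ∀ n ∈ F, e.det (Sum.elim v n) = 0 := by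
  refine ⟨fun h n hn => ?_, fun h => eq_zero_of_locally (A := A) _ fun p => ?_⟩
  · obtain ⟨Φ, hΦ⟩ := exists_linearMap_wedge e hr
      (fun p => (hgen p).imp fun n hn => ⟨hF n hn.1, hn.2⟩) (hF n hn)
    rw [← hΦ, h, map_zero]
  · obtain ⟨n, hn, w, hδ⟩ := hgen p
    obtain ⟨c, hc, hcg⟩ := exists_coeff_alternating e (hF n hn) w v
    rw [h n hn, mul_zero] at hc
    -- The power `k` pulls the scalar out of the `k` entries of the wedge; the power `|κ| + 1` then
    -- makes the coefficient `c` vanish.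
    refine ⟨e.det (Sum.elim w n) ^ (Fintype.card κ + 1) * e.det (Sum.elim w n) ^ k, ?_, ?_⟩
    · exact fun hmem => (p.2.mem_or_mem hmem).elim (fun h => hδ (p.2.mem_of_pow_mem _ h))
        fun h => hδ (p.2.mem_of_pow_mem _ h)
    · have := hcg (exteriorPower.ιMulti A k)
      rw [Fintype.card_fin] at this
      rw [mul_smul, this, ← mul_smul, ← hc, zero_smul]

theorem residue_wedge_ne_zero_iff_det (e : Module.Basis (Fin k ⊕ κ) A M)
    (hr : ∀ p, Module.rankAtStalk (R := A) (M ⧸ N) p = k) (F : Set (κ → M))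
    (hF : ∀ n ∈ F, ∀ i, n i ∈ N)
    (hgen : ∀ p : PrimeSpectrum A, ∃ n ∈ F, ∃ w : Fin k → M, e.det (Sum.elim w n) ∉ p.asIdeal)
    (v : Fin k → M) (p : PrimeSpectrum A) :
    (1 : p.asIdeal.ResidueField) ⊗ₜ[A] exteriorPower.ιMulti A k (fun b => N.mkQ (v b)) ≠ 0 ↔
      ∃ n ∈ F, e.det (Sum.elim v n) ∉ p.asIdeal := by
  refine ⟨fun h => ?_, fun ⟨n, hn, hv⟩ => ?_⟩
  · by_contra! hall
    obtain ⟨n, hn, w, hδ⟩ := hgen p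
    obtain ⟨c, hc, hcg⟩ := exists_coeff_alternating e (hF n hn) w v
    have hcp : c ∈ p.asIdeal := by
      have h1 := Ideal.mul_mem_left _ (e.det (Sum.elim w n) ^ Fintype.card (Fin k ⊕ κ)) (hall n hn)
      rw [hc] at h1
      exact (p.2.mem_or_mem h1).resolve_left fun h => hδ (p.2.mem_of_pow_mem _ h)
    apply h
    refine residue_tmul_eq_zero_of_smul p
      (a := e.det (Sum.elim w n) ^ Fintype.card (Fin k)) (fun h => hδ (p.2.mem_of_pow_mem _ h)) ?_
    rw [hcg (exteriorPower.ιMulti A k)]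
    exact residue_tmul_smul_eq_zero p hcp _
  · obtain ⟨Φ, hΦ⟩ := exists_linearMap_wedge e hr
      (fun p => (hgen p).imp fun n hn => ⟨hF n hn.1, hn.2⟩) (hF n hn)
    exact residue_tmul_ne_zero p Φ (by rwa [hΦ])

/-- A wedge is zero if all of its products into the top degree are. -/
theorem wedge_eq_zero_of_append (e : Module.Basis (Fin k ⊕ κ) A M)
    (hr : ∀ p, Module.rankAtStalk (R := A) (M ⧸ N) p = k) (E : Set M)
    (hgen : ∀ p : PrimeSpectrum A, ∃ n : κ → M, (∀ i, n i ∈ N) ∧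
      ∃ w : Fin k → M, (∀ b, w b ∈ E) ∧ e.det (Sum.elim w n) ∉ p.asIdeal)
    {l : ℕ} (u : Fin l → M)
    (h : ∀ (j : ℕ) (z : Fin j → M), (∀ b, z b ∈ E) → l + j = k →
      exteriorPower.ιMulti A (l + j)
        (Fin.append (fun b => N.mkQ (u b)) fun b => N.mkQ (z b)) = 0) :
    exteriorPower.ιMulti A l (fun b => N.mkQ (u b)) = 0 := by
  classical
  have hgen' : ∀ p : PrimeSpectrum A, ∃ n : κ → M, (∀ i, n i ∈ N) ∧
      ∃ w : Fin k → M, e.det (Sum.elim w n) ∉ p.asIdeal := fun p =>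
    (hgen p).imp fun n hn => ⟨hn.1, hn.2.imp fun w hw => hw.2⟩
  refine wedge_eq_zero_of_detForms e fun η => eq_zero_of_locally (A := A) _ fun p => ?_
  obtain ⟨n, hn, w, hwE, hδ⟩ := hgen p
  set δ := e.det (Sum.elim w n) with hδdef
  -- The `θ b` are the Cramer coordinates along `w`: up to the factor `δ`, the dual basis of the
  -- classes of `w`.
  have hdual : ∀ b, ∃ θ : (M ⧸ N) →ₗ[A] A, ∀ x,
      θ (N.mkQ x) = e.det (Sum.elim (Function.update w b x) n) := by
    intro b
    obtain ⟨g, hg⟩ := exists_alternating_quotient (N := N) (fixRight e.det n) fun v b hb =>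
      det_eq_zero_of_mem e (by simpa using hr) hgen' hn v b hb
    refine ⟨g.toMultilinearMap.toLinearMap (fun c => N.mkQ (w c)) b, fun x => ?_⟩
    rw [← fixRight_apply, ← hg]
    change g _ = g _
    congr 1
    funext c
    rcases eq_or_ne c b with rfl | hc
    · simp
    · simp [hc]
  choose θ hθ using hdual
  have hθw : ∀ b c, θ b (N.mkQ (w c)) = if b = c then δ else 0 := by
    intro b c
    rw [hθ, ← Sum.update_elim_inl]
    exact (update_self_entry e (Sum.elim w n) (Sum.inl b) (Sum.inl c)).trans
      (if_congr Sum.inl_injective.eq_iff rfl rfl)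
  have hexp : ∀ (f : (M ⧸ N) →ₗ[A] A) (y : M ⧸ N), δ * f y = ∑ b, f (N.mkQ (w b)) * θ b y := by
    intro f y
    obtain ⟨x, rfl⟩ := N.mkQ_surjective y
    have := congrArg f (smul_mkQ_eq_sum e hn w x)
    rw [map_smul, map_sum, smul_eq_mul] at this
    rw [this]
    refine Finset.sum_congr rfl fun b _ => ?_
    rw [map_smul, hθ, smul_eq_mul, mul_comm]
  -- Complete `u` by the `w b` with `b` outside the range of `φ`. Testing the resulting zero wedge
  -- on all `θ` gives a block triangular matrix with a block `δ • 1`.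
  have hinj : ∀ φ : Fin l → Fin k, Function.Injective φ →
      δ ^ (k - l) * detForms (fun j => θ (φ j)) (fun b => N.mkQ (u b)) = 0 := by
    intro φ hφ
    have hlk : l ≤ k := by simpa using Fintype.card_le_of_injective φ hφ
    have hcard : Fintype.card ((Set.range φ)ᶜ : Set (Fin k)) = k - l := by
      rw [Fintype.card_compl_set, Set.card_range_of_injective hφ]
      simp
    let ψ : Fin (k - l) ≃ ((Set.range φ)ᶜ : Set (Fin k)) := (Fintype.equivFinOfCardEq hcard).symm
    have hz := h (k - l) (fun b => w (ψ b)) (fun b => hwE _) (by omega)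
    have h0 := apply_eq_zero_of_wedge_eq_zero
      ((detForms (Sum.elim (fun j => θ (φ j)) fun j => θ (ψ j))).domDomCongr finSumFinEquiv) hz
    rw [AlternatingMap.domDomCongr_apply, detForms_apply] at h0
    have hblock : (Matrix.of fun i j => (Sum.elim (fun j => θ (φ j)) fun j => θ (ψ j)) j
        ((Fin.append (fun b => N.mkQ (u b)) (fun b => N.mkQ (w (ψ b))) ∘ finSumFinEquiv) i)) =
        Matrix.fromBlocks (Matrix.of fun i j => θ (φ j) (N.mkQ (u i)))
          (Matrix.of fun i j => θ (ψ j) (N.mkQ (u i))) 0 (δ • (1 : Matrix _ _ A)) := by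
      ext (i | i) (j | j)
      · simp
      · simp
      · have hne : φ j ≠ ψ i := fun heq => (ψ i).2 ⟨j, heq⟩
        simpa [hne] using hθw (φ j) (ψ i)
      · have := hθw (ψ j) (ψ i)
        simp only [Subtype.coe_inj, ψ.injective.eq_iff] at this
        simpa [Matrix.one_apply, eq_comm] using this
    have h0' := (congrArg Matrix.det hblock).symm.trans h0
    rw [Matrix.det_fromBlocks_zero₂₁, Matrix.det_smul, Matrix.det_one, mul_one, mul_comm,
      Fintype.card_fin] at h0'
    rw [detForms_apply]
    exact h0'
  refine ⟨δ ^ (k - l) * δ ^ l, fun hmem => (p.2.mem_or_mem hmem).elim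
    (fun h => hδ (p.2.mem_of_pow_mem _ h)) fun h => hδ (p.2.mem_of_pow_mem _ h), ?_⟩
  -- Each `η j` expands in the `θ b`. By multilinearity only injective `φ` contribute, so for `l >
  -- k` nothing remains and the hypothesis on completions is not needed.
  have h1 : δ ^ l * detForms η (fun b => N.mkQ (u b)) =
      Matrix.detRowAlternating (fun j => ∑ b, η j (N.mkQ (w b)) • fun i => θ b (N.mkQ (u i))) := by
    have h2 : (fun j => ∑ b, η j (N.mkQ (w b)) • fun i => θ b (N.mkQ (u i))) =
        fun j => (fun _ : Fin l => δ) j • fun i => η j (N.mkQ (u i)) := by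
      funext j i
      simp only [Finset.sum_apply, Pi.smul_apply, smul_eq_mul]
      exact (hexp (η j) (N.mkQ (u i))).symm
    rw [h2, AlternatingMap.map_smul_univ, Finset.prod_const, Finset.card_univ, Fintype.card_fin,
      smul_eq_mul, detForms_apply, ← Matrix.det_transpose]
    rfl
  rw [smul_eq_mul, mul_assoc, h1]
  change _ * Matrix.detRowAlternating.toMultilinearMap _ = 0
  rw [MultilinearMap.map_sum, Finset.mul_sum]
  refine Finset.sum_eq_zero fun φ _ => ?_
  rw [MultilinearMap.map_smul_univ, smul_eq_mul, mul_left_comm]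
  by_cases hφ : Function.Injective φ
  · have := hinj φ hφ
    rw [detForms_apply, ← Matrix.det_transpose] at this
    exact mul_eq_zero_of_right _ this
  · refine mul_eq_zero_of_right _ (mul_eq_zero_of_right _ ?_)
    simp only [Function.Injective, not_forall] at hφ
    obtain ⟨i, j, hij, hne⟩ := hφ
    exact Matrix.detRowAlternating.map_eq_zero_of_eq _ (by simp only [hij]) hne

end TopDegree

end Wedge

/-! ### Coefficients of forms -/

section Coefficients

variable {A : Type v} [CommRing A]

theorem expo_apply_zero (d i : ℕ) : expo d i 0 = d - i := by simp [expo]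

theorem expo_apply_one (d i : ℕ) : expo d i 1 = i := by simp [expo]

theorem expo_inj {d i j : ℕ} : expo d i = expo d j ↔ i = j :=
  ⟨fun h => by simpa [expo_apply_one] using DFunLike.congr_fun h 1, fun h => h ▸ rfl⟩

theorem eq_expo {d : ℕ} {s : Fin 2 →₀ ℕ} (hs : s.degree = d) : s = expo d (s 1) := by
  have h : s 0 + s 1 = d := by
    rw [← hs, Finsupp.degree_eq_sum, Fin.sum_univ_two]
  ext i
  fin_cases i
  · simp [expo]
    omega
  · simp [expo]

/-- The basis of monomials of the forms of degree `d`. -/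
def monoBasis (A : Type v) [CommRing A] (d : ℕ) : Module.Basis (Fin (d + 1)) A (Forms A d) :=
  .ofEquivFun <| LinearEquiv.ofBijective
    (LinearMap.pi fun i : Fin (d + 1) => MvPolynomial.lcoeff A (expo d i) ∘ₗ (Forms A d).subtype) <| by
    constructor
    · rw [injective_iff_map_eq_zero]
      intro f hf
      ext s
      by_cases hs : s.degree = d
      · have h1 : s 1 < d + 1 := by
          have h : s 0 + s 1 = d := by
            rw [← hs, Finsupp.degree_eq_sum, Fin.sum_univ_two]
          omega
        have := congrFun hf ⟨s 1, h1⟩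
        rw [eq_expo hs]
        simpa using this
      · exact ((MvPolynomial.mem_homogeneousSubmodule _ _).1 f.2).coeff_eq_zero hs
    · intro c
      refine ⟨∑ i, c i • mono A d i, ?_⟩
      funext j
      simp [mono, MvPolynomial.coeff_monomial,
        expo_inj, Fin.val_inj]

theorem monoBasis_repr {d : ℕ} (f : Forms A d) (i : Fin (d + 1)) :
    (monoBasis A d).repr f i = (f : MvPolynomial (Fin 2) A).coeff (expo d i) := rfl

theorem monoBasis_apply {d : ℕ} (i : Fin (d + 1)) : monoBasis A d i = mono A d i := by
  apply (monoBasis A d).repr.injective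
  ext j
  rw [Module.Basis.repr_self, monoBasis_repr, mono, MvPolynomial.coeff_monomial,
    Finsupp.single_apply]
  simp [expo_inj, Fin.val_inj]

/-- The products of a form `f` of degree `k` and the monomials of degree `h - 1`. -/
def shift {k h d : ℕ} (hd : d + 1 = h + k) (f : Forms A k) (i : Fin h) : Forms A d :=
  ⟨(f : MvPolynomial (Fin 2) A) * MvPolynomial.monomial (expo (h - 1) i) 1, by
    rw [MvPolynomial.mem_homogeneousSubmodule]
    have := ((MvPolynomial.mem_homogeneousSubmodule _ _).1 f.2).mul
      ((MvPolynomial.mem_homogeneousSubmodule _ _).1 (mono A (h - 1) ⟨i, by omega⟩).2)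
    have hi := i.2
    rwa [show k + (h - 1) = d by omega] at this⟩

theorem coeff_shift {k h d : ℕ} (hd : d + 1 = h + k) (f : Forms A k) (i : Fin h) (j : ℕ)
    (hj : j ≤ d) : (shift hd f i : MvPolynomial (Fin 2) A).coeff (expo d j) =
      if (i : ℕ) ≤ j ∧ j - i ≤ k then (f : MvPolynomial (Fin 2) A).coeff (expo k (j - i)) else 0 := by
  rw [shift, MvPolynomial.coeff_mul_monomial', mul_one]
  have hi := i.2
  have hle : expo (h - 1) i ≤ expo d j ↔ (i : ℕ) ≤ j ∧ j - i ≤ k := by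
    rw [Finsupp.le_def, Fin.forall_fin_two]
    simp only [expo_apply_zero, expo_apply_one]
    omega
  refine if_ctx_congr hle (fun h => ?_) fun _ => rfl
  congr 1
  ext t
  rw [Finsupp.tsub_apply]
  revert t
  rw [Fin.forall_fin_two]
  simp only [expo_apply_zero, expo_apply_one]
  exact ⟨by omega, trivial⟩

/-- The monomials of degree `d = h + k - 1`, split into the last `k` and the first `h` ones. -/
def splitIndex {k h d : ℕ} (hd : d + 1 = h + k) : Fin k ⊕ Fin h ≃ Fin (d + 1) :=
  (Equiv.sumComm _ _).trans (finSumFinEquiv.trans (finCongr hd.symm))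

theorem splitIndex_inl {k h d : ℕ} (hd : d + 1 = h + k) (b : Fin k) :
    (splitIndex hd (Sum.inl b) : ℕ) = h + b := by simp [splitIndex]

theorem splitIndex_inr {k h d : ℕ} (hd : d + 1 = h + k) (i : Fin h) :
    (splitIndex hd (Sum.inr i) : ℕ) = i := by simp [splitIndex]

/-- The monomial basis, indexed by `splitIndex`. -/
def splitBasis (A : Type v) [CommRing A] {k h d : ℕ} (hd : d + 1 = h + k) :
    Module.Basis (Fin k ⊕ Fin h) A (Forms A d) :=
  (monoBasis A d).reindex (splitIndex hd).symm

/-- A basis of the forms of degree `h + k - 1`, modulo a prime not containing all coefficients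
of `f`, is given by the multiples of `f` and by `k` monomials. -/
theorem exists_det_shift_notMem {k h d : ℕ} (hd : d + 1 = h + k) (f : Forms A k)
    (p : Ideal A) [hp : p.IsPrime]
    (hf : ∃ j : Fin (k + 1), (f : MvPolynomial (Fin 2) A).coeff (expo k j) ∉ p) :
    ∃ w : Fin k → Fin (d + 1),
      (splitBasis A hd).det (Sum.elim (fun b => mono A d (w b)) (shift hd f)) ∉ p := by
  classical
  have hex : ∃ j : ℕ, j ≤ k ∧ (f : MvPolynomial (Fin 2) A).coeff (expo k j) ∉ p :=
    hf.elim fun j hj => ⟨j, j.is_le, hj⟩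
  -- Let `a_j` be the first coefficient outside `p`. The monomials complementary to the window of
  -- `y`-exponents `j, …, j + h - 1` are taken as `w`; on the window the multiples of `f` form,
  -- modulo `p`, a triangular matrix with diagonal `a_j`.
  obtain ⟨j, ⟨hjk, hj⟩, hmin⟩ : ∃ j, (j ≤ k ∧ (f : MvPolynomial (Fin 2) A).coeff (expo k j) ∉ p) ∧
      ∀ i < j, (f : MvPolynomial (Fin 2) A).coeff (expo k i) ∈ p := by
    refine ⟨Nat.find hex, Nat.find_spec hex, fun i hi => ?_⟩
    by_contra hcon
    exact Nat.find_min hex hi ⟨hi.le.trans (Nat.find_spec hex).1, hcon⟩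
  let g : Fin k ⊕ Fin h → Fin (d + 1) := Sum.elim
    (fun b => if hb : (b : ℕ) < j then ⟨b, by omega⟩ else ⟨b + h, by omega⟩)
    (fun i => ⟨j + i, by omega⟩)
  have hg : Function.Bijective g := by
    rw [Fintype.bijective_iff_injective_and_card]
    constructor
    · rintro (b | i) (b' | i') hbb
      all_goals
        simp only [g, Sum.elim_inl, Sum.elim_inr] at hbb
        try split_ifs at hbb
        all_goals
          simp only [Fin.mk.injEq] at hbb
          first
          | (exfalso; omega)
          | (congr 1; ext; omega)
    · simp
      omega
  let ε := Equiv.ofBijective g hg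
  let e' : Module.Basis (Fin k ⊕ Fin h) A (Forms A d) := (monoBasis A d).reindex ε.symm
  have he' : ∀ s, e' s = mono A d (g s) := fun s => by
    simp [e', monoBasis_apply, ε]
  refine ⟨fun b => g (Sum.inl b), ?_⟩
  set v := Sum.elim (fun b => mono A d (g (Sum.inl b))) (shift hd f)
  rw [AlternatingMap.eq_smul_basis_det e' (splitBasis A hd).det, AlternatingMap.smul_apply,
    smul_eq_mul]
  refine fun hmem => (hp.mem_or_mem hmem).elim
    (fun h => hp.ne_top (Ideal.eq_top_of_isUnit_mem _ h ((splitBasis A hd).isUnit_det e'))) ?_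
  have hblock : e'.toMatrix v = Matrix.fromBlocks 1
      (Matrix.of fun b i => e'.repr (shift hd f i) (Sum.inl b)) 0
      (Matrix.of fun i' i => e'.repr (shift hd f i) (Sum.inr i')) := by
    ext (b | i) (b' | i')
    · simp only [Module.Basis.toMatrix_apply, v, Sum.elim_inl, ← he', Module.Basis.repr_self,
        Matrix.fromBlocks_apply₁₁, Matrix.one_apply, Finsupp.single_apply]
      simp [eq_comm]
    · rfl
    · simp only [Module.Basis.toMatrix_apply, v, Sum.elim_inl, ← he', Module.Basis.repr_self]
      simp
    · rfl
  rw [Module.Basis.det_apply, hblock, Matrix.det_fromBlocks_zero₂₁, Matrix.det_one, one_mul]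
  have hrepr : ∀ i' i, e'.repr (shift hd f i) (Sum.inr i') =
      if (i : ℕ) ≤ j + i' ∧ j + i' - i ≤ k then
        (f : MvPolynomial (Fin 2) A).coeff (expo k (j + i' - i)) else 0 := by
    intro i' i
    rw [← coeff_shift hd f i _ (by omega)]
    simp only [e', Module.Basis.repr_reindex, Finsupp.mapDomain_equiv_apply, Equiv.symm_symm]
    rfl
  intro hmem
  rw [← Ideal.Quotient.eq_zero_iff_mem, RingHom.map_det, Matrix.det_of_isLowerTriangular] at hmem
  · rw [Finset.prod_eq_zero_iff] at hmem
    obtain ⟨i, -, hi⟩ := hmem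
    rw [RingHom.mapMatrix_apply, Matrix.map_apply, Matrix.of_apply, hrepr,
      Ideal.Quotient.eq_zero_iff_mem] at hi
    rw [if_pos (by omega), Nat.add_sub_cancel] at hi
    exact hj hi
  · intro i' i hii
    have hii' : i' < i := hii
    rw [RingHom.mapMatrix_apply, Matrix.map_apply, Matrix.of_apply, hrepr,
      Ideal.Quotient.eq_zero_iff_mem]
    split_ifs with hc
    · exact hmin _ (by omega)
    · exact zero_mem _

end Coefficients

/-! ### Local structure of points of the Hilbert scheme -/

namespace HilbPoint

variable {k : ℕ} {A : Type v} [CommRing A]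

instance (I : HilbPoint k A) (d : ℕ) : Module.Projective A (Forms A d ⧸ I.piece d) :=
  I.projective d

/-- Otherwise all `k + 1` coefficient functions would descend to `Q_k` modulo `p`, forcing rank at
least `k + 1` where the rank is `k`. -/
theorem exists_coeff_notMem (I : HilbPoint k A) (p : PrimeSpectrum A) : ∃ f ∈ I.piece k,
    ∃ j : Fin (k + 1), (f : MvPolynomial (Fin 2) A).coeff (expo k j) ∉ p.asIdeal := by
  classical
  by_contra! hcon
  have : Module.Finite A (Forms A k) := Module.Finite.of_basis (monoBasis A k)
  let L : Forms A k →ₗ[A] (Fin (k + 1) → p.asIdeal.ResidueField) :=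
    LinearMap.pi fun j => Algebra.linearMap A _ ∘ₗ (monoBasis A k).coord j
  let g := (I.piece k).liftQ L (fun f hf => by
    rw [LinearMap.mem_ker]
    funext j
    exact Ideal.algebraMap_residueField_eq_zero.2 (hcon f hf j))
  have h := card_le_rankAtStalk p g (by
    rw [eq_top_iff, ← (Pi.basisFun p.asIdeal.ResidueField (Fin (k + 1))).span_eq,
      Submodule.span_le]
    rintro _ ⟨j, rfl⟩
    refine Submodule.subset_span ⟨(I.piece k).mkQ (monoBasis A k j), ?_⟩
    funext i
    simp only [g, Submodule.mkQ_apply, Submodule.liftQ_apply, L, LinearMap.pi_apply,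
      LinearMap.comp_apply, Module.Basis.coord_apply, Module.Basis.repr_self,
      Algebra.linearMap_apply, Pi.basisFun_apply, Finsupp.single_apply, Pi.single_apply]
    split_ifs <;> simp_all)
  rw [I.rank, Fintype.card_fin, hilbFun, if_neg (lt_irrefl k)] at h
  omega

theorem shift_mem (I : HilbPoint k A) {h d : ℕ} (hd : d + 1 = h + k) {f : Forms A k}
    (hf : f ∈ I.piece k) (i : Fin h) : shift hd f i ∈ I.piece d :=
  I.ideal.mul_mem_right _ hf

/-- The families of multiples of elements of `I_k` in degree `h + k - 1`. -/
def shifts (I : HilbPoint k A) {h d : ℕ} (hd : d + 1 = h + k) : Set (Fin h → Forms A d) :=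
  {n | ∃ f ∈ I.piece k, n = shift hd f}

theorem mem_of_mem_shifts (I : HilbPoint k A) {h d : ℕ} (hd : d + 1 = h + k)
    {n : Fin h → Forms A d} (hn : n ∈ I.shifts hd) (i : Fin h) : n i ∈ I.piece d := by
  obtain ⟨f, hf, rfl⟩ := hn
  exact I.shift_mem hd hf i

theorem exists_mem_shifts (I : HilbPoint k A) {h d : ℕ} (hd : d + 1 = h + k)
    (p : PrimeSpectrum A) : ∃ n ∈ I.shifts hd, ∃ w : Fin k → Fin (d + 1),
      (splitBasis A hd).det (Sum.elim (fun b => mono A d (w b)) n) ∉ p.asIdeal := by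
  obtain ⟨f, hf, hj⟩ := I.exists_coeff_notMem p
  exact ⟨_, ⟨f, hf, rfl⟩, exists_det_shift_notMem hd f p.asIdeal hj⟩

theorem rank_eq (I : HilbPoint k A) {h d : ℕ} (hd : d + 1 = h + k) (p : PrimeSpectrum A) :
    Module.rankAtStalk (Forms A d ⧸ I.piece d) p = k := by
  rw [I.rank, hilbFun]
  split_ifs <;> omega

/-- For `d < k` the rank `d + 1` of the quotient equals the number of monomials, so their classes
satisfy no nonzero relation. -/
theorem eq_zero_of_mem_piece (I : HilbPoint k A) {d : ℕ} (hd : d < k) {f : Forms A d}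
    (hf : f ∈ I.piece d) : f = 0 := by
  have : Module.Finite A (Forms A d) := Module.Finite.of_basis (monoBasis A d)
  refine eq_zero_of_locally (A := A) f fun p => ?_
  obtain ⟨t, ht, htc⟩ := exists_mul_coeff_eq_zero p
    (Q := Forms A d ⧸ I.piece d) (ι := Fin (d + 1)) (by simp [I.rank, hilbFun, hd])
    (fun i => (I.piece d).mkQ (monoBasis A d i)) (δ := 1)
    (fun h => p.2.ne_top ((Ideal.eq_top_iff_one _).2 h))
    (fun x => by
      obtain ⟨y, rfl⟩ := (I.piece d).mkQ_surjective x
      rw [one_smul, ← (monoBasis A d).sum_repr y, map_sum]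
      exact sum_mem fun i _ => by
        rw [map_smul]
        exact Submodule.smul_mem _ _ (Submodule.subset_span ⟨i, rfl⟩))
    (fun i => (monoBasis A d).repr f i) (by
      simp only [← map_smul, ← map_sum, (monoBasis A d).sum_repr]
      simpa using hf)
  refine ⟨t, ht, ?_⟩
  apply (monoBasis A d).repr.injective
  ext i
  simpa using htc i

/-- The wedge of the classes of the monomials of a family. -/
def wedgeFamily (I : HilbPoint k A) {d l : ℕ} (u : Fin l → Fin (d + 1)) :
    ⋀[A]^l (I.QuotPiece d) :=
  exteriorPower.ιMulti A l fun b => (I.piece d).mkQ (mono A d (u b))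

theorem wedgeFamily_perm (I : HilbPoint k A) {d l : ℕ} (u : Fin l → Fin (d + 1))
    (σ : Equiv.Perm (Fin l)) :
    I.wedgeFamily (u ∘ σ) = Equiv.Perm.sign σ • I.wedgeFamily u :=
  (exteriorPower.ιMulti A l).map_perm (fun b => (I.piece d).mkQ (mono A d (u b))) σ

/-- The wedge of a set of monomials vanishes, on `A` or at a point, together with the wedge of any
enumeration of the set. -/
theorem wedge_image_eq_zero_iff (I : HilbPoint k A) {d l : ℕ} {u : Fin l → Fin (d + 1)}
    (hu : Function.Injective u) :
    (I.wedge (Finset.univ.image u) = 0 ↔ I.wedgeFamily u = 0) ∧ ∀ p : PrimeSpectrum A,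
      ((1 : p.asIdeal.ResidueField) ⊗ₜ[A] I.wedge (Finset.univ.image u) = 0 ↔
        (1 : p.asIdeal.ResidueField) ⊗ₜ[A] I.wedgeFamily u = 0) := by
  classical
  set U := Finset.univ.image u with hU
  have hcard : l = U.card := by simp [hU, Finset.card_image_of_injective _ hu]
  clear_value U
  subst hcard
  set o : Fin U.card → Fin (d + 1) := fun i => U.orderEmbOfFin rfl i
  have ho : Set.range o = Set.range u := by
    rw [Finset.range_orderEmbOfFin]
    exact (congrArg (fun s : Finset (Fin (d + 1)) => (s : Set (Fin (d + 1)))) hU).trans (by simp)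
  have hoi : Function.Injective o := (U.orderEmbOfFin rfl).injective
  let σ : Equiv.Perm (Fin U.card) := (Equiv.ofInjective u hu).trans
    ((Equiv.setCongr ho.symm).trans (Equiv.ofInjective o hoi).symm)
  have hσ : u = o ∘ σ := by
    funext i
    have h := Equiv.apply_ofInjective_symm hoi ((Equiv.setCongr ho.symm) (Equiv.ofInjective u hu i))
    exact h.symm
  have key : I.wedgeFamily u = Equiv.Perm.sign σ • I.wedge U := by
    rw [hσ]
    exact I.wedgeFamily_perm o σ
  rw [key]
  rcases Int.units_eq_one_or (Equiv.Perm.sign σ) with h | h <;> rw [h] <;>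
    simp [Units.smul_def, TensorProduct.tmul_neg]

end HilbPoint

/-! ### Polynomials in the coefficients, symmetric polynomials in the roots -/

section Coefficients

theorem aeval_mul_of_isHomogeneous {𝕜 : Type*} [Field 𝕜] {A : Type*} [CommRing A] [Algebra 𝕜 A]
    {σ : Type*} [Fintype σ] {F : MvPolynomial σ 𝕜} {n : ℕ} (hF : F.IsHomogeneous n) (c : A)
    (a : σ → A) :
    MvPolynomial.aeval (fun j => c * a j) F = c ^ n * MvPolynomial.aeval a F := by
  rw [MvPolynomial.aeval_def, MvPolynomial.aeval_def, MvPolynomial.eval₂_eq',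
    MvPolynomial.eval₂_eq', Finset.mul_sum]
  refine Finset.sum_congr rfl fun s hs => ?_
  have h1 : ∑ i, s i = n := by
    have := hF (MvPolynomial.mem_support_iff.1 hs)
    rw [← this, Finsupp.weight_apply, Finsupp.sum_fintype _ _ (by simp)]
    simp
  simp only [mul_pow, Finset.prod_mul_distrib, Finset.prod_pow_eq_pow_sum, h1]
  ring

theorem evalCoeffs_smul {k : ℕ} {𝕜 : Type u} [Field 𝕜] {A : Type v} [CommRing A] [Algebra 𝕜 A]
    {F : MvPolynomial (Fin (k + 1)) 𝕜} {n : ℕ} (hF : F.IsHomogeneous n) (c : A)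
    (f : MvPolynomial (Fin 2) A) : evalCoeffs F (c • f) = c ^ n * evalCoeffs F f := by
  simp only [evalCoeffs, MvPolynomial.coeff_smul, smul_eq_mul]
  exact aeval_mul_of_isHomogeneous hF c _

theorem aeval_eq_sum_coeff {A : Type v} [CommRing A] {B : Type*} [CommRing B] [Algebra A B]
    {d : ℕ} (f : Forms A d) (a b : B) :
    MvPolynomial.aeval ![a, b] (f : MvPolynomial (Fin 2) A) =
      ∑ i : Fin (d + 1), algebraMap A B ((f : MvPolynomial (Fin 2) A).coeff (expo d i)) *
        (a ^ (d - i) * b ^ (i : ℕ)) := by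
  conv_lhs => rw [← (monoBasis A d).sum_repr f]
  simp only [monoBasis_repr, monoBasis_apply, Submodule.coe_sum, Submodule.coe_smul, map_sum,
    map_smul, mono, MvPolynomial.aeval_monomial, map_one, one_mul]
  refine Finset.sum_congr rfl fun i _ => ?_
  rw [Algebra.smul_def, Finsupp.prod_fintype _ _ (by simp), Fin.prod_univ_two, expo_apply_zero, expo_apply_one]
  rfl

theorem isHomogeneous_rootForm (k : ℕ) (𝕜 : Type u) [Field 𝕜] :
    (rootForm k 𝕜).IsHomogeneous k := by
  have := MvPolynomial.IsHomogeneous.prod (Finset.univ : Finset (Fin k))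
    (fun i => MvPolynomial.C (ry k 𝕜 i) * MvPolynomial.X 0 -
      MvPolynomial.C (rx k 𝕜 i) * MvPolynomial.X (1 : Fin 2)) (fun _ => 1)
    (fun i _ => (MvPolynomial.isHomogeneous_C_mul_X _ _).sub
      (MvPolynomial.isHomogeneous_C_mul_X _ _))
  rw [Finset.sum_const, Finset.card_univ, Fintype.card_fin, smul_eq_mul, mul_one] at this
  exact this

/-- `rootForm`, as an element of the module of forms. -/
def rootForm' (k : ℕ) (𝕜 : Type u) [Field 𝕜] : Forms (RootRing k 𝕜) k :=
  ⟨rootForm k 𝕜, (MvPolynomial.mem_homogeneousSubmodule _ _).2 (isHomogeneous_rootForm k 𝕜)⟩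

theorem aeval_rootForm (k : ℕ) (𝕜 : Type u) [Field 𝕜] {B : Type*} [CommRing B]
    [Algebra (RootRing k 𝕜) B] (a b : B) : MvPolynomial.aeval ![a, b] (rootForm k 𝕜) =
      ∏ i, (algebraMap _ B (ry k 𝕜 i) * a - algebraMap _ B (rx k 𝕜 i) * b) := by
  simp [rootForm, map_prod]

theorem elem_zero (k : ℕ) (𝕜 : Type u) [Field 𝕜] : elem k 𝕜 0 = ∏ i, ry k 𝕜 i := by
  simp [elem]

theorem elem_zero_ne_zero (k : ℕ) (𝕜 : Type u) [Field 𝕜] : elem k 𝕜 0 ≠ 0 := by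
  rw [elem_zero]
  exact Finset.prod_ne_zero_iff.2 fun i _ => MvPolynomial.X_ne_zero _

theorem coeff_rootForm_zero (k : ℕ) (𝕜 : Type u) [Field 𝕜] :
    (rootForm k 𝕜).coeff (expo k 0) = elem k 𝕜 0 := by
  have h := aeval_rootForm k 𝕜 (1 : RootRing k 𝕜) 0
  have h2 := aeval_eq_sum_coeff (rootForm' k 𝕜) (1 : RootRing k 𝕜) 0
  rw [Fin.sum_univ_succ] at h2
  rw [elem_zero]
  simpa [h, rootForm'] using h2.symm

/-- The coefficients of the specialization of `rootForm` at `y_i = 1`. -/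
theorem specialize_coeff_rootForm (k : ℕ) (𝕜 : Type u) [Field 𝕜] (m : Fin (k + 1)) :
    MvPolynomial.aeval (fun s : Fin k × Fin 2 =>
      if s.2 = 0 then (MvPolynomial.X s.1 : MvPolynomial (Fin k) 𝕜) else 1)
      ((rootForm k 𝕜).coeff (expo k m)) =
      (-1) ^ (m : ℕ) * MvPolynomial.esymm (Fin k) 𝕜 m := by
  set ψ := MvPolynomial.aeval (R := 𝕜) (fun s : Fin k × Fin 2 =>
    if s.2 = 0 then (MvPolynomial.X s.1 : MvPolynomial (Fin k) 𝕜) else 1)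
  let : Algebra (RootRing k 𝕜) (Polynomial (MvPolynomial (Fin k) 𝕜)) :=
    (Polynomial.C.comp ψ.toRingHom).toAlgebra
  have halg : ∀ a, algebraMap (RootRing k 𝕜) (Polynomial (MvPolynomial (Fin k) 𝕜)) a =
    Polynomial.C (ψ a) := fun a => rfl
  have h1 := aeval_rootForm k 𝕜 (Polynomial.X : Polynomial (MvPolynomial (Fin k) 𝕜)) 1
  have h2 := aeval_eq_sum_coeff (rootForm' k 𝕜)
    (Polynomial.X : Polynomial (MvPolynomial (Fin k) 𝕜)) 1
  have h3 := congrArg (fun q => Polynomial.coeff q (k - m)) (h2.symm.trans h1)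
  have hψx : ∀ i, ψ (rx k 𝕜 i) = MvPolynomial.X i := fun i => by simp [ψ]
  have hψy : ∀ i, ψ (ry k 𝕜 i) = 1 := fun i => by simp [ψ]
  -- Vieta's formula, read off in the coefficient of `X ^ (k - m)`.
  simp only [halg, hψx, hψy, map_one, one_mul, mul_one, one_pow, Polynomial.finsetSum_coeff,
    Polynomial.coeff_C_mul, Polynomial.coeff_X_pow] at h3
  rw [Finset.sum_eq_single m] at h3
  · rw [if_pos rfl, mul_one] at h3
    refine Eq.trans h3 ?_
    have h4 := Multiset.prod_X_sub_C_coeff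
      ((Finset.univ : Finset (Fin k)).val.map (MvPolynomial.X (R := 𝕜))) (k := k - m) (by simp)
    rw [Multiset.map_map] at h4
    refine Eq.trans h4 ?_
    have hm := m.is_le
    rw [MvPolynomial.esymm_eq_multiset_esymm]
    simp [Nat.sub_sub_self hm]
  · intro i _ hi
    have hi' : (i : ℕ) ≠ m := fun h => hi (Fin.ext h)
    have := i.is_le
    have := m.is_le
    rw [if_neg (by omega), mul_zero]
  · simp

/-- At `y_i = 1` the coefficients become `1` and the signed elementary symmetric polynomials. The
latter are algebraically independent, so the dehomogenization `F (1, …)` is zero, and with it the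
homogeneous `F`. -/
theorem eq_zero_of_evalCoeffs_rootForm {k : ℕ} {𝕜 : Type u} [Field 𝕜]
    {F : MvPolynomial (Fin (k + 1)) 𝕜} {n : ℕ} (hF : F.IsHomogeneous n)
    (h0 : evalCoeffs F (rootForm k 𝕜) = 0) : F = 0 := by
  let G : MvPolynomial (Fin k) 𝕜 := MvPolynomial.aeval
    (Fin.cons 1 fun i : Fin k => (-1) ^ ((i : ℕ) + 1) * MvPolynomial.X i) F
  have hG : G = 0 := by
    apply MvPolynomial.esymmAlgHom_injective (σ := Fin k) (n := k) 𝕜 (by simp)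
    rw [map_zero]
    apply Subtype.ext
    have h1 := congrArg (MvPolynomial.aeval (R := 𝕜) (fun s : Fin k × Fin 2 =>
      if s.2 = 0 then (MvPolynomial.X s.1 : MvPolynomial (Fin k) 𝕜) else 1)) h0
    rw [evalCoeffs, ← AlgHom.comp_apply, MvPolynomial.comp_aeval, map_zero] at h1
    simp only [specialize_coeff_rootForm] at h1
    rw [← Subalgebra.coe_val, ← AlgHom.comp_apply, ← AlgHom.comp_apply, MvPolynomial.comp_aeval]
    refine Eq.trans ?_ h1
    congr 2
    funext i
    refine Fin.cases ?_ (fun i => ?_) i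
    · simp
    · simp [MvPolynomial.esymmAlgHom]
  -- Rehomogenize in the fraction field: `F (X) = X_0 ^ n * F (1, X_i / X_0)`.
  let L := FractionRing (MvPolynomial (Fin (k + 1)) 𝕜)
  let X' : Fin (k + 1) → L := fun i => algebraMap (MvPolynomial (Fin (k + 1)) 𝕜) L (MvPolynomial.X i)
  have hX0 : X' 0 ≠ 0 := by
    simp only [X', ne_eq, FaithfulSMul.algebraMap_eq_zero_iff]
    exact MvPolynomial.X_ne_zero _
  have h1 : MvPolynomial.aeval (Fin.cons 1 fun i : Fin k => X' i.succ / X' 0 : Fin (k + 1) → L) F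
      = 0 := by
    have h2 := congrArg (MvPolynomial.aeval
      (fun i : Fin k => (-1) ^ ((i : ℕ) + 1) * (X' i.succ / X' 0))) hG
    rw [map_zero] at h2
    simp only [G] at h2
    rw [← AlgHom.comp_apply, MvPolynomial.comp_aeval] at h2
    refine Eq.trans ?_ h2
    congr 2
    funext i
    refine Fin.cases ?_ (fun i => ?_) i
    · simp
    · have h3 : (-1 : L) ^ ((i : ℕ) + 1) * (-1) ^ ((i : ℕ) + 1) = 1 := by
        rw [← mul_pow, neg_one_mul, neg_neg, one_pow]
      simp [← mul_assoc, h3]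
  have h2 := aeval_mul_of_isHomogeneous hF (X' 0)
    (Fin.cons 1 fun i : Fin k => X' i.succ / X' 0 : Fin (k + 1) → L)
  rw [h1, mul_zero] at h2
  have h3 : (fun j => X' 0 * (Fin.cons 1 fun i : Fin k => X' i.succ / X' 0 : Fin (k + 1) → L) j) =
      fun j => (IsScalarTower.toAlgHom 𝕜 (MvPolynomial (Fin (k + 1)) 𝕜) L) (MvPolynomial.X j) := by
    funext j
    refine Fin.cases ?_ (fun i => ?_) j
    · simp [X']
    · simp only [Fin.cons_succ]
      rw [mul_div_cancel₀ _ hX0]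
      simp [X']
  rw [h3, ← MvPolynomial.comp_aeval_apply] at h2
  simpa using h2

/-- Makes the existential quantifier over `F` in `vanishingScheme` and `vanishingCompl` harmless. -/
theorem Corresponds.unique {k : ℕ} {𝕜 : Type u} [Field 𝕜] {n : ℕ}
    {F F' : MvPolynomial (Fin (k + 1)) 𝕜} {G : RootRing k 𝕜} (h : Corresponds n F G)
    (h' : Corresponds n F' G) : F = F' := by
  rw [← sub_eq_zero]
  refine eq_zero_of_evalCoeffs_rootForm (h.1.sub h'.1) ?_
  have h1 := h.2
  have h2 := h'.2
  rw [evalCoeffs] at h1 h2 ⊢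
  rw [map_sub, h1, h2, sub_self]

/-- The determinant of `k` monomials and the multiples of a form of degree `k`, as a polynomial in
the coefficients of the form. -/
def detPoly (𝕜 : Type u) [Field 𝕜] {k h d : ℕ} (hd : d + 1 = h + k) (u : Fin k → Fin (d + 1)) :
    MvPolynomial (Fin (k + 1)) 𝕜 :=
  Matrix.det (Matrix.of fun s r : Fin k ⊕ Fin h => Sum.elim
    (fun b : Fin k => if u b = splitIndex hd s then 1 else 0)
    (fun i : Fin h => if hi : (i : ℕ) ≤ splitIndex hd s ∧ (splitIndex hd s : ℕ) - i ≤ k then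
      MvPolynomial.X ⟨(splitIndex hd s : ℕ) - i, Nat.lt_succ_of_le hi.2⟩ else 0) r)

theorem isHomogeneous_detPoly (𝕜 : Type u) [Field 𝕜] {k h d : ℕ} (hd : d + 1 = h + k)
    (u : Fin k → Fin (d + 1)) : (detPoly 𝕜 hd u).IsHomogeneous h := by
  rw [detPoly, Matrix.det_apply]
  refine MvPolynomial.IsHomogeneous.sum _ _ _ fun σ _ => ?_
  have hdeg : ∑ r : Fin k ⊕ Fin h, Sum.elim (fun _ => 0) (fun _ => 1) r = h := by simp
  have hp : (∏ r, (Matrix.of fun s r : Fin k ⊕ Fin h => Sum.elim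
      (fun b : Fin k => if u b = splitIndex hd s then (1 : MvPolynomial (Fin (k + 1)) 𝕜) else 0)
      (fun i : Fin h => if hi : (i : ℕ) ≤ splitIndex hd s ∧ (splitIndex hd s : ℕ) - i ≤ k then
        MvPolynomial.X ⟨(splitIndex hd s : ℕ) - i, Nat.lt_succ_of_le hi.2⟩ else 0) r)
        (σ r) r).IsHomogeneous h := by
    conv => arg 2; rw [← hdeg]
    refine MvPolynomial.IsHomogeneous.prod _ _ _ fun r _ => ?_
    rcases r with b | i
    · simp only [Matrix.of_apply, Sum.elim_inl]
      split_ifs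
      · exact MvPolynomial.isHomogeneous_one _ _
      · exact MvPolynomial.isHomogeneous_zero _ _ _
    · simp only [Matrix.of_apply, Sum.elim_inr]
      split_ifs
      · exact MvPolynomial.isHomogeneous_X _ _
      · exact MvPolynomial.isHomogeneous_zero _ _ _
  rcases Int.units_eq_one_or (Equiv.Perm.sign σ) with hs | hs <;> rw [hs]
  · simpa using hp
  · simpa using hp.neg

theorem splitBasis_repr {A : Type v} [CommRing A] {k h d : ℕ} (hd : d + 1 = h + k) (f : Forms A d)
    (s : Fin k ⊕ Fin h) : (splitBasis A hd).repr f s =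
      (f : MvPolynomial (Fin 2) A).coeff (expo d (splitIndex hd s)) := by
  simp only [splitBasis, Module.Basis.repr_reindex, Finsupp.mapDomain_equiv_apply,
    Equiv.symm_symm]
  rfl

theorem evalCoeffs_detPoly {𝕜 : Type u} [Field 𝕜] {A : Type v} [CommRing A] [Algebra 𝕜 A]
    {k h d : ℕ} (hd : d + 1 = h + k) (u : Fin k → Fin (d + 1)) (f : Forms A k) :
    evalCoeffs (detPoly 𝕜 hd u) (f : MvPolynomial (Fin 2) A) =
      (splitBasis A hd).det (Sum.elim (fun b => mono A d (u b)) (shift hd f)) := by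
  rw [evalCoeffs, detPoly, AlgHom.map_det, Module.Basis.det_apply]
  congr 1
  ext s (b | i)
  · rw [Module.Basis.toMatrix_apply, splitBasis_repr, Sum.elim_inl, mono,
      MvPolynomial.coeff_monomial]
    by_cases hus : u b = splitIndex hd s <;> simp [hus, expo_inj, Fin.val_inj]
  · rw [Module.Basis.toMatrix_apply, splitBasis_repr, Sum.elim_inr, coeff_shift _ _ _ _ (Fin.is_le _)]
    simp only [AlgHom.mapMatrix_apply, Matrix.map_apply, Matrix.of_apply, Sum.elim_inr]
    split_ifs <;> simp

end Coefficients

/-! ### The determinant as a Schur polynomial in the roots -/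

section Schur

variable {k : ℕ} [NeZero k]

/-- The row of the `j`-th root has the common factor `y_j ^ (h - λ_1)`; what remains is the
transposed alternant. -/
theorem det_eval_monomials (𝕜 : Type u) [Field 𝕜] {h d : ℕ} (hd : d + 1 = h + k)
    {lam : Fin k → ℕ} (hlam : Antitone lam) (hh : lam 0 ≤ h) :
    (Matrix.of fun j b : Fin k => rx k 𝕜 j ^ (d - (h - lam b + b)) *
      ry k 𝕜 j ^ (h - lam b + b)).det = elem k 𝕜 0 ^ (h - lam 0) * alternant k 𝕜 (shifted lam) := by
  rw [alternant, elem_zero, ← Finset.prod_pow, ← Matrix.det_mul_row, ← Matrix.det_transpose]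
  congr 1
  ext b j : 1
  simp only [Matrix.transpose_apply, Matrix.of_apply]
  have h1 := hlam (Fin.zero_le b)
  have h2 := b.isLt
  rw [mul_left_comm, ← pow_add]
  simp only [shifted, Fin.val_zero]
  congr 2 <;> omega

theorem corresponds_detPoly (𝕜 : Type u) [Field 𝕜] {h d : ℕ} (hd : d + 1 = h + k)
    {lam : Fin k → ℕ} (hlam : Antitone lam) (hh : lam 0 ≤ h) {u : Fin k → Fin (d + 1)}
    (hu : ∀ b, (u b : ℕ) = h - lam b + b) :
    Corresponds h (detPoly 𝕜 hd u) (elem k 𝕜 0 ^ (h - lam 0) * schur k 𝕜 lam hlam) := by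
  refine ⟨isHomogeneous_detPoly 𝕜 hd u, ?_⟩
  let R := RootRing k 𝕜
  have hform : evalCoeffs (detPoly 𝕜 hd u) (rootForm k 𝕜) =
    evalCoeffs (detPoly 𝕜 hd u) (rootForm' k 𝕜 : MvPolynomial (Fin 2) R) := rfl
  rw [hform, evalCoeffs_detPoly, Module.Basis.det_apply]
  set V := (splitBasis R hd).toMatrix (Sum.elim (fun b => mono R d (u b)) (shift hd (rootForm' k 𝕜)))
    with hV
  let ev : Fin k → ℕ → R := fun j i => rx k 𝕜 j ^ (d - i) * ry k 𝕜 j ^ i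
  -- Upper rows evaluate a form at the roots; lower rows read its coordinates at the first `h`
  -- monomials. The determinant of `E` is that of evaluating the last `k` monomials, the case `λ =
  -- 0`.
  let E : Matrix (Fin k ⊕ Fin h) (Fin k ⊕ Fin h) R := Matrix.fromBlocks
    (Matrix.of fun j b => ev j (h + b)) (Matrix.of fun j i => ev j i) 0 1
  have hE : E.det = elem k 𝕜 0 ^ h * alternant k 𝕜 (shifted 0) := by
    rw [Matrix.det_fromBlocks_zero₂₁, Matrix.det_one, mul_one]
    have := det_eval_monomials (k := k) 𝕜 hd (lam := 0) (fun _ _ _ => le_rfl) (Nat.zero_le h)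
    simpa using this
  have hev : ∀ (j : Fin k) (f : Forms R d),
      ∑ s, E (Sum.inl j) s * (splitBasis R hd).repr f s =
        MvPolynomial.aeval ![rx k 𝕜 j, ry k 𝕜 j] (f : MvPolynomial (Fin 2) R) := by
    intro j f
    rw [aeval_eq_sum_coeff, ← (splitIndex hd).sum_comp]
    refine Finset.sum_congr rfl fun s _ => ?_
    rw [splitBasis_repr, mul_comm]
    congr 1
    rcases s with b | i
    · simp [E, ev, splitIndex_inl]
    · simp [E, ev, splitIndex_inr]
  have hprod : E * V = Matrix.fromBlocks
      (Matrix.of fun j b => rx k 𝕜 j ^ (d - (h - lam b + b)) * ry k 𝕜 j ^ (h - lam b + b)) 0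
      (Matrix.of fun i b => V (Sum.inr i) (Sum.inl b))
      (Matrix.of fun i' i => V (Sum.inr i') (Sum.inr i)) := by
    ext (j | i') (b | i) : 1
    · rw [Matrix.mul_apply, Matrix.fromBlocks_apply₁₁]
      simp only [hV, Module.Basis.toMatrix_apply]
      rw [hev, Sum.elim_inl, mono, MvPolynomial.aeval_monomial, map_one, one_mul,
        Finsupp.prod_fintype _ _ (by simp), Fin.prod_univ_two, expo_apply_zero, expo_apply_one, hu]
      rfl
    · rw [Matrix.mul_apply, Matrix.fromBlocks_apply₁₂]
      simp only [hV, Module.Basis.toMatrix_apply]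
      rw [hev, Sum.elim_inr, shift, map_mul]
      have : MvPolynomial.aeval ![rx k 𝕜 j, ry k 𝕜 j] (rootForm' k 𝕜 : MvPolynomial (Fin 2) R) = 0 := by
        refine (aeval_rootForm k 𝕜 (rx k 𝕜 j) (ry k 𝕜 j)).trans ?_
        refine Finset.prod_eq_zero (Finset.mem_univ j) ?_
        simp only [Algebra.algebraMap_self, RingHom.id_apply]
        ring
      rw [this, zero_mul]
      rfl
    · simp [Matrix.mul_apply, E, Matrix.one_apply]
    · simp [Matrix.mul_apply, E, Matrix.one_apply]
  -- This Toeplitz block is lower triangular, with the leading coefficient `e_0` of the root form on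
  -- its diagonal.
  have hT : (Matrix.of fun i' i => V (Sum.inr i') (Sum.inr i)).det = elem k 𝕜 0 ^ h := by
    have hVT : ∀ i' i, V (Sum.inr i') (Sum.inr i) = if (i : ℕ) ≤ i' ∧ (i' : ℕ) - i ≤ k then
        (rootForm k 𝕜).coeff (expo k (i' - i)) else 0 := by
      intro i' i
      rw [hV, Module.Basis.toMatrix_apply, splitBasis_repr, Sum.elim_inr,
        coeff_shift _ _ _ _ (Fin.is_le _), splitIndex_inr]
      rfl
    rw [Matrix.det_of_isLowerTriangular]
    · simp [hVT, coeff_rootForm_zero]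
    · intro i' i hii
      have hii' : i' < i := hii
      rw [Matrix.of_apply, hVT, if_neg (by omega)]
  have hdet := congrArg Matrix.det hprod
  rw [Matrix.det_mul, hE, Matrix.det_fromBlocks_zero₁₂, hT, det_eval_monomials 𝕜 hd hlam hh,
    schur_spec k 𝕜 lam hlam] at hdet
  have hne : elem k 𝕜 0 ^ h * alternant k 𝕜 (shifted 0) ≠ 0 :=
    mul_ne_zero (pow_ne_zero _ (elem_zero_ne_zero k 𝕜)) (alternant_zero_ne_zero k 𝕜)
  apply mul_left_cancel₀ hne
  rw [hdet]
  ring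

end Schur

/-! ### Monomial sets of partitions -/

section Rim

variable {k : ℕ}

theorem rimPath_succ (h : ℕ) (lam : Fin k → ℕ) (i : ℕ) :
    rimPath h lam (i + 1) = rimStep lam (rimPath h lam i) :=
  Function.iterate_succ_apply' _ _ _

/-- Invariant of the walk: rows above the current height have been passed and the others have not,
the vertical step along row `c` being number `h - lam c + c`. -/
theorem rimPath_spec {h : ℕ} {lam : Fin k → ℕ} (hlam : Antitone lam) (hh : ∀ b, lam b ≤ h)
    (i : ℕ) (hi : i ≤ h + k) :
    (rimPath h lam i).1 + i = h + (rimPath h lam i).2 ∧ (rimPath h lam i).1 ≤ h ∧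
      (rimPath h lam i).2 ≤ k ∧
      (∀ c : Fin k, (c : ℕ) < (rimPath h lam i).2 → h - lam c + c < i) ∧
      ∀ c : Fin k, (rimPath h lam i).2 ≤ c → i ≤ h - lam c + c := by
  induction i with
  | zero => simp [rimPath]
  | succ i ih =>
    obtain ⟨h1, h2, h3, h4, h5⟩ := ih (by omega)
    rw [rimPath_succ]
    generalize rimPath h lam i = P at *
    obtain ⟨a, b⟩ := P
    simp only [rimStep] at *
    split_ifs with hc
    · obtain ⟨hb, hab⟩ := hc
      simp only
      refine ⟨by omega, h2, by omega, fun c hcb => ?_, fun c hcb => ?_⟩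
      · rcases Nat.lt_succ_iff_lt_or_eq.1 hcb with h | h
        · have := h4 c h
          omega
        · have : c = ⟨b, hb⟩ := Fin.ext h
          subst this
          simp only
          omega
      · have hle : (⟨b, hb⟩ : Fin k) ≤ c := Fin.mk_le_of_le_val (by omega)
        have := hlam hle
        omega
    · simp only
      -- A step to the left never starts in column `0`, so the truncated subtraction `a - 1` is
      -- genuine.
      have ha : 1 ≤ a := by
        by_contra hlt
        have ha0 : a = 0 := by omega
        have hb : b < k := by omega
        have := h5 ⟨b, hb⟩ le_rfl
        have h7 := hh ⟨b, hb⟩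
        simp only at this
        exact hc ⟨hb, by omega⟩
      refine ⟨by omega, by omega, h3, fun c hcb => ?_, fun c hcb => ?_⟩
      · have := h4 c hcb
        omega
      · have hb : b < k := by omega
        have hle : (⟨b, hb⟩ : Fin k) ≤ c := Fin.mk_le_of_le_val hcb
        have h6 := hlam hle
        have h7 := h5 ⟨b, hb⟩ le_rfl
        have h8 := hh ⟨b, hb⟩
        have h9 : lam ⟨b, hb⟩ ≠ a := fun h => hc ⟨hb, h⟩
        simp only at h7
        omega

theorem mem_monomialSet {h : ℕ} {lam : Fin k → ℕ} (hlam : Antitone lam) (hh : ∀ b, lam b ≤ h)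
    (i : Fin (h + k - 1 + 1)) (hi : (i : ℕ) < h + k) :
    i ∈ monomialSet h lam ↔ ∃ b : Fin k, (i : ℕ) = h - lam b + b := by
  obtain ⟨h1, h2, h3, h4, h5⟩ := rimPath_spec hlam hh i hi.le
  rw [monomialSet, Finset.mem_filter, rimPath_succ]
  generalize rimPath h lam i = P at *
  obtain ⟨a, b⟩ := P
  simp only [rimStep, Finset.mem_univ, true_and] at *
  constructor
  · intro hstep
    split_ifs at hstep with hc
    · obtain ⟨hb, hab⟩ := hc
      exact ⟨⟨b, hb⟩, by simp only; omega⟩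
    · simp at hstep
  · rintro ⟨c, hc⟩
    have hbc : b ≤ c := by
      by_contra hlt
      have := h4 c (by omega)
      omega
    have hb : b < k := by omega
    have h6 := h5 ⟨b, hb⟩ le_rfl
    have hle : (⟨b, hb⟩ : Fin k) ≤ c := Fin.mk_le_of_le_val hbc
    have h7 := hlam hle
    have h8 := hh ⟨b, hb⟩
    simp only at h6
    rw [if_pos ⟨hb, by omega⟩]

/-- The `y`-exponents of the monomials in the set of a partition. -/
def partIndex [NeZero k] (h : ℕ) (lam : Fin k → ℕ) (b : Fin k) : Fin (h + k - 1 + 1) :=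
  ⟨h - lam b + b, by
    have := b.isLt
    omega⟩

theorem partIndex_injective [NeZero k] {h : ℕ} {lam : Fin k → ℕ} (hlam : Antitone lam)
    (hh : lam 0 ≤ h) : Function.Injective (partIndex h lam) := by
  intro b c hbc
  have h0 := hlam (Fin.zero_le b)
  have h0' := hlam (Fin.zero_le c)
  have h1 : h - lam b + b = h - lam c + c := congrArg Fin.val hbc
  rcases le_total b c with hle | hle
  · have := hlam hle
    have : (b : ℕ) ≤ c := hle
    ext
    omega
  · have := hlam hle
    have : (c : ℕ) ≤ b := hle
    ext
    omega

theorem monomialSet_eq_image [NeZero k] {h : ℕ} {lam : Fin k → ℕ} (hlam : Antitone lam)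
    (hh : lam 0 ≤ h) : monomialSet h lam = Finset.univ.image (partIndex h lam) := by
  have hk := NeZero.pos k
  ext i
  rw [mem_monomialSet hlam (fun b => (hlam (Fin.zero_le b)).trans hh) i (by omega),
    Finset.mem_image]
  simp only [Finset.mem_univ, true_and, Fin.ext_iff, partIndex]
  exact exists_congr fun b => eq_comm

/-- If `o` enumerates the exponents increasingly, `o b = h - λ_b + b` is solved by `λ_b = h + b - o
b`. Strict growth of `o` gives `b ≤ o b ≤ h + b` and the monotonicity of `λ`. -/
theorem exists_partition [NeZero k] {h : ℕ} (u : Fin k → Fin (h + k - 1 + 1))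
    (hu : Function.Injective u) : ∃ lam : Fin k → ℕ, Antitone lam ∧ lam 0 ≤ h ∧
      Finset.univ.image u = monomialSet h lam := by
  have hk := NeZero.pos k
  have hcard : (Finset.univ.image u).card = k := by
    rw [Finset.card_image_of_injective _ hu, Finset.card_univ, Fintype.card_fin]
  let o : Fin k → Fin (h + k - 1 + 1) := (Finset.univ.image u).orderEmbOfFin hcard
  have ho : StrictMono o := ((Finset.univ.image u).orderEmbOfFin hcard).strictMono
  have hstep : ∀ (m : ℕ) (b c : Fin k), (b : ℕ) + m = c → (o b : ℕ) + m ≤ o c := by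
    intro m
    induction m with
    | zero =>
      intro b c hbc
      have : b = c := Fin.ext hbc
      rw [this]
      rfl
    | succ m ih =>
      intro b c hbc
      have h1 := ih b ⟨b + m, by omega⟩ rfl
      have h2 : (⟨b + m, by omega⟩ : Fin k) < c := Fin.mk_lt_of_lt_val (by omega)
      have h3 : (o ⟨b + m, by omega⟩ : ℕ) < o c := ho h2
      omega
  have hlow : ∀ b : Fin k, (b : ℕ) ≤ o b := fun b => by
    have := hstep b 0 b (by simp)
    omega
  have hup : ∀ b : Fin k, (o b : ℕ) ≤ h + b := fun b => by
    have := hstep (k - 1 - b) b ⟨k - 1, by omega⟩ (by simp only; omega)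
    have := (o ⟨k - 1, by omega⟩).is_le
    omega
  have hanti : Antitone fun b => h + b - (o b : ℕ) := by
    intro b c hbc
    have hbc' : (b : ℕ) ≤ c := hbc
    have := hstep (c - b) b c (by omega)
    simp only
    omega
  have h0 : (fun b : Fin k => h + b - (o b : ℕ)) 0 ≤ h := by simp
  refine ⟨fun b => h + b - (o b : ℕ), hanti, h0, ?_⟩
  rw [monomialSet_eq_image hanti h0]
  have hoi : Finset.univ.image u = Finset.univ.image o := by
    apply Finset.coe_injective
    rw [Finset.coe_image (f := o), Finset.coe_univ, Set.image_univ]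
    exact (Finset.range_orderEmbOfFin _ hcard).symm
  rw [hoi]
  congr 1
  funext b
  ext
  have := hlow b
  have := hup b
  simp only [partIndex]
  omega

end Rim

/-! ### Dependence schemes and zero schemes -/

namespace HilbPoint

variable {k : ℕ} {A : Type v} [CommRing A]

theorem wedgeFamily_eq_zero_iff {𝕜 : Type u} [Field 𝕜] [Algebra 𝕜 A] (I : HilbPoint k A)
    {h d : ℕ} (hd : d + 1 = h + k) (u : Fin k → Fin (d + 1)) :
    I.wedgeFamily u = 0 ↔
      ∀ f ∈ I.piece k, evalCoeffs (detPoly 𝕜 hd u) (f : MvPolynomial (Fin 2) A) = 0 := by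
  refine (wedge_eq_zero_iff_det (splitBasis A hd) (I.rank_eq hd) (I.shifts hd)
    (fun n hn => I.mem_of_mem_shifts hd hn)
    (fun p => (I.exists_mem_shifts hd p).imp fun n hn => ⟨hn.1, hn.2.imp' _ fun w hw => hw⟩)
    (fun b => mono A d (u b))).trans ?_
  simp only [evalCoeffs_detPoly]
  exact ⟨fun H f hf => H _ ⟨f, hf, rfl⟩, fun H n ⟨f, hf, hn⟩ => hn ▸ H f hf⟩

theorem residue_wedgeFamily_ne_zero_iff {𝕜 : Type u} [Field 𝕜] [Algebra 𝕜 A] (I : HilbPoint k A)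
    {h d : ℕ} (hd : d + 1 = h + k) (u : Fin k → Fin (d + 1)) (p : PrimeSpectrum A) :
    (1 : p.asIdeal.ResidueField) ⊗ₜ[A] I.wedgeFamily u ≠ 0 ↔ ∃ f ∈ I.piece k,
      evalCoeffs (detPoly 𝕜 hd u) (f : MvPolynomial (Fin 2) A) ∉ p.asIdeal := by
  refine (residue_wedge_ne_zero_iff_det (splitBasis A hd) (I.rank_eq hd) (I.shifts hd)
    (fun n hn => I.mem_of_mem_shifts hd hn)
    (fun p => (I.exists_mem_shifts hd p).imp fun n hn => ⟨hn.1, hn.2.imp' _ fun w hw => hw⟩)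
    (fun b => mono A d (u b)) p).trans ?_
  simp only [evalCoeffs_detPoly]
  exact ⟨fun ⟨n, ⟨f, hf, hn⟩, H⟩ => ⟨f, hf, hn ▸ H⟩, fun ⟨f, hf, H⟩ => ⟨_, ⟨f, hf, rfl⟩, H⟩⟩

theorem wedgeFamily_eq_zero_of_append (I : HilbPoint k A) {h d : ℕ} (hd : d + 1 = h + k) {l : ℕ}
    (u : Fin l → Fin (d + 1))
    (H : ∀ (j : ℕ) (z : Fin j → Fin (d + 1)), l + j = k → I.wedgeFamily (Fin.append u z) = 0) :
    I.wedgeFamily u = 0 := by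
  refine wedge_eq_zero_of_append (splitBasis A hd) (I.rank_eq hd) (Set.range (mono A d))
    (fun p => ?_) (fun b => mono A d (u b)) fun j z hz hj => ?_
  · obtain ⟨n, hn, w, hw⟩ := I.exists_mem_shifts hd p
    exact ⟨n, I.mem_of_mem_shifts hd hn, _, fun b => ⟨w b, rfl⟩, hw⟩
  · choose z' hz' using hz
    obtain rfl : z = fun b => mono A d (z' b) := funext fun b => (hz' b).symm
    rw [← H j z' hj, wedgeFamily]
    congr 1
    funext i
    refine Fin.addCases (fun i => ?_) (fun i => ?_) i <;> simp

theorem wedgeFamily_append (I : HilbPoint k A) {d l j : ℕ} (u : Fin l → Fin (d + 1))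
    (z : Fin j → Fin (d + 1)) : I.wedgeFamily (Fin.append u z) =
      exteriorPower.ιMulti A (l + j) (Fin.append (fun b => (I.piece d).mkQ (mono A d (u b)))
        fun b => (I.piece d).mkQ (mono A d (z b))) := by
  rw [wedgeFamily]
  congr 1
  funext i
  refine Fin.addCases (fun i => ?_) (fun i => ?_) i <;> simp

theorem wedgeFamily_append_eq_zero (I : HilbPoint k A) {d l j : ℕ} {u : Fin l → Fin (d + 1)}
    (z : Fin j → Fin (d + 1)) (h : I.wedgeFamily u = 0) :
    I.wedgeFamily (Fin.append u z) = 0 := by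
  rw [wedgeFamily_append]
  exact wedge_append_eq_zero _ h

theorem wedgeFamily_eq_zero_of_not_injective (I : HilbPoint k A) {d l : ℕ}
    {u : Fin l → Fin (d + 1)} (hu : ¬ Function.Injective u) : I.wedgeFamily u = 0 := by
  simp only [Function.Injective, not_forall] at hu
  obtain ⟨i, j, hij, hne⟩ := hu
  exact (exteriorPower.ιMulti A l).map_eq_zero_of_eq _ (by simp only [hij]) hne

theorem residue_wedgeFamily_ne_zero_of_append (I : HilbPoint k A) {d l j : ℕ}
    {u : Fin l → Fin (d + 1)} (z : Fin j → Fin (d + 1)) (p : PrimeSpectrum A)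
    (h : (1 : p.asIdeal.ResidueField) ⊗ₜ[A] I.wedgeFamily (Fin.append u z) ≠ 0) :
    (1 : p.asIdeal.ResidueField) ⊗ₜ[A] I.wedgeFamily u ≠ 0 := by
  rw [wedgeFamily_append] at h
  exact residue_wedge_ne_zero_of_append _ p h

/-- As `I_d = 0`, the monomial coordinates descend to `Q_d`, and on distinct monomials they give the
identity matrix. -/
theorem residue_wedgeFamily_ne_zero_of_lt (I : HilbPoint k A) {d l : ℕ} (hd : d < k)
    {u : Fin l → Fin (d + 1)} (hu : Function.Injective u) (p : PrimeSpectrum A) :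
    (1 : p.asIdeal.ResidueField) ⊗ₜ[A] I.wedgeFamily u ≠ 0 := by
  let η : Fin l → I.QuotPiece d →ₗ[A] A := fun j =>
    (I.piece d).liftQ ((monoBasis A d).coord (u j)) fun f hf => by
      rw [I.eq_zero_of_mem_piece hd hf]
      exact zero_mem _
  refine residue_tmul_ne_zero p (exteriorPower.alternatingMapLinearEquiv (detForms η)) ?_
  rw [wedgeFamily, exteriorPower.alternatingMapLinearEquiv_apply_ιMulti, detForms_apply]
  have : (Matrix.of fun i j => η j ((I.piece d).mkQ (mono A d (u i)))) = 1 := by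
    ext i j
    rw [Matrix.of_apply, Submodule.mkQ_apply, Submodule.liftQ_apply, ← monoBasis_apply,
      Module.Basis.coord_apply, Module.Basis.repr_self, Finsupp.single_apply, Matrix.one_apply]
    exact if_congr hu.eq_iff rfl rfl
  rw [this, Matrix.det_one]
  exact fun h => p.2.ne_top ((Ideal.eq_top_iff_one _).2 h)

/-- A local generator of `I_k` at a prime. -/
theorem exists_local_generator {𝕜 : Type u} [Field 𝕜] [Algebra 𝕜 A] (I : HilbPoint k A)
    (p : PrimeSpectrum A) : ∃ f₀ ∈ I.piece k, ∀ (n : ℕ) (F : MvPolynomial (Fin (k + 1)) 𝕜),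
      F.IsHomogeneous n →
      (∃ f ∈ I.piece k, evalCoeffs F (f : MvPolynomial (Fin 2) A) ∉ p.asIdeal) →
      evalCoeffs F (f₀ : MvPolynomial (Fin 2) A) ∉ p.asIdeal := by
  -- The case `h = 1`, `d = k`, in which the only multiple is `f₀` itself.
  have hd : k + 1 = 1 + k := add_comm _ _
  obtain ⟨f₀, hf₀, hj⟩ := I.exists_coeff_notMem p
  obtain ⟨w, hδ⟩ := exists_det_shift_notMem hd f₀ p.asIdeal hj
  refine ⟨f₀, hf₀, fun n F hF ⟨f, hf, hfp⟩ h0 => hfp ?_⟩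
  set δ := (splitBasis A hd).det (Sum.elim (fun b => mono A k (w b)) (shift hd f₀))
  have hshift : shift hd f₀ 0 = f₀ := by
    apply Subtype.ext
    have h00 : expo 0 0 = 0 := by simp [expo]
    simp [shift, h00]
  obtain ⟨c, hc⟩ : ∃ c : A, δ • f = c • f₀ := by
    refine ⟨(splitBasis A hd).det (Function.update
      (Sum.elim (fun b => mono A k (w b)) (shift hd f₀)) (Sum.inr 0) f), ?_⟩
    rw [det_smul_eq_sum, Fintype.sum_sum_type, Finset.sum_eq_zero, zero_add, Fin.sum_univ_one,
      Sum.elim_inr, hshift]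
    intro b _
    -- The Cramer coefficients along the monomials contain both `f` and `f₀` from `I_k`, one entry
    -- too many, so only the multiple of `f₀` survives.
    rw [Sum.update_elim_inl, det_eq_zero_of_mem (N := I.piece k) (splitBasis A hd)
      (fun p => by simpa using I.rank_eq hd p)
      (fun p => ?_) (I.shift_mem hd hf₀) _ b (by rwa [Function.update_self]), zero_smul]
    obtain ⟨n, hn, w, hw⟩ := I.exists_mem_shifts hd p
    exact ⟨n, I.mem_of_mem_shifts hd hn, _, hw⟩
  have h1 : δ ^ n * evalCoeffs F (f : MvPolynomial (Fin 2) A) =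
      c ^ n * evalCoeffs F (f₀ : MvPolynomial (Fin 2) A) := by
    rw [← evalCoeffs_smul hF, ← evalCoeffs_smul hF, ← Submodule.coe_smul, hc, Submodule.coe_smul]
  have h2 := Ideal.mul_mem_left _ (c ^ n) h0
  rw [← h1] at h2
  exact (p.2.mem_or_mem h2).resolve_left fun h => hδ (p.2.mem_of_pow_mem _ h)

end HilbPoint

/-! ### Dependence schemes as zero schemes of sections -/

section Schemes

variable {k : ℕ} {𝕜 : Type u} [Field 𝕜] {A : Type v} [CommRing A] [Algebra 𝕜 A]

theorem Corresponds.mem_vanishingScheme_iff {n : ℕ} {F : MvPolynomial (Fin (k + 1)) 𝕜}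
    {G : RootRing k 𝕜} (h : Corresponds n F G) (I : HilbPoint k A) :
    I ∈ vanishingScheme n G A ↔
      ∀ f ∈ I.piece k, evalCoeffs F (f : MvPolynomial (Fin 2) A) = 0 :=
  ⟨fun ⟨_, hF', H⟩ => hF'.unique h ▸ H, fun H => ⟨F, h, H⟩⟩

theorem Corresponds.mem_vanishingCompl_iff {n : ℕ} {F : MvPolynomial (Fin (k + 1)) 𝕜}
    {G : RootRing k 𝕜} (h : Corresponds n F G) (I : HilbPoint k A) :
    I ∈ vanishingCompl n G A ↔ ∀ p : PrimeSpectrum A,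
      ∃ f ∈ I.piece k, evalCoeffs F (f : MvPolynomial (Fin 2) A) ∉ p.asIdeal :=
  ⟨fun ⟨_, hF', H⟩ => hF'.unique h ▸ H, fun H => ⟨F, h, H⟩⟩

theorem Corresponds.mul {n n' : ℕ} {F F' : MvPolynomial (Fin (k + 1)) 𝕜} {G G' : RootRing k 𝕜}
    (h : Corresponds n F G) (h' : Corresponds n' F' G') :
    Corresponds (n + n') (F * F') (G * G') :=
  ⟨h.1.mul h'.1, by rw [← h.2, ← h'.2]; exact map_mul _ _ _⟩

theorem Corresponds.pow {n : ℕ} {F : MvPolynomial (Fin (k + 1)) 𝕜} {G : RootRing k 𝕜}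
    (h : Corresponds n F G) (m : ℕ) : Corresponds (n * m) (F ^ m) (G ^ m) :=
  ⟨h.1.pow m, by rw [← h.2]; exact map_pow _ _ _⟩

theorem evalCoeffs_pow_mul (E F : MvPolynomial (Fin (k + 1)) 𝕜) (m : ℕ)
    (f : MvPolynomial (Fin 2) A) :
    evalCoeffs (E ^ m * F) f = evalCoeffs E f ^ m * evalCoeffs F f := by
  simp only [evalCoeffs, map_mul, map_pow]

theorem corresponds_elem_zero : Corresponds 1 (MvPolynomial.X 0) (elem k 𝕜 0) :=
  ⟨MvPolynomial.isHomogeneous_X _ _, by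
    rw [evalCoeffs, MvPolynomial.aeval_X, ← coeff_rootForm_zero]
    rfl⟩

variable [NeZero k]

theorem corresponds_partIndex (𝕜 : Type u) [Field 𝕜] {h : ℕ} (hd : h + k - 1 + 1 = h + k)
    {lam : Fin k → ℕ} (hlam : Antitone lam) (hh : lam 0 ≤ h) :
    Corresponds h (detPoly 𝕜 hd (partIndex h lam))
      (elem k 𝕜 0 ^ (h - lam 0) * schur k 𝕜 lam hlam) :=
  corresponds_detPoly 𝕜 hd hlam hh fun _ => rfl

theorem mem_dependenceScheme_iff {h : ℕ} {lam : Fin k → ℕ} (hlam : Antitone lam) (hh : lam 0 ≤ h)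
    (I : HilbPoint k A) : I ∈ dependenceScheme k (monomialSet h lam) A ↔
      I ∈ vanishingScheme h (elem k 𝕜 0 ^ (h - lam 0) * schur k 𝕜 lam hlam) A := by
  have hd : h + k - 1 + 1 = h + k := by have := NeZero.pos k; omega
  rw [(corresponds_partIndex 𝕜 hd hlam hh).mem_vanishingScheme_iff,
    ← I.wedgeFamily_eq_zero_iff, monomialSet_eq_image hlam hh]
  exact (I.wedge_image_eq_zero_iff (partIndex_injective hlam hh)).1

theorem mem_dependenceCompl_iff {h : ℕ} {lam : Fin k → ℕ} (hlam : Antitone lam) (hh : lam 0 ≤ h)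
    (I : HilbPoint k A) : I ∈ dependenceCompl k (monomialSet h lam) A ↔
      I ∈ vanishingCompl h (elem k 𝕜 0 ^ (h - lam 0) * schur k 𝕜 lam hlam) A := by
  have hd : h + k - 1 + 1 = h + k := by have := NeZero.pos k; omega
  rw [(corresponds_partIndex 𝕜 hd hlam hh).mem_vanishingCompl_iff, monomialSet_eq_image hlam hh]
  refine forall_congr' fun p => ?_
  rw [← I.residue_wedgeFamily_ne_zero_iff]
  exact ((I.wedge_image_eq_zero_iff (partIndex_injective hlam hh)).2 p).not

theorem schur_zero (k : ℕ) [NeZero k] (𝕜 : Type u) [Field 𝕜] (h0 : Antitone (0 : Fin k → ℕ)) :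
    schur k 𝕜 0 h0 = 1 := by
  have h := schur_spec k 𝕜 0 h0
  exact (mul_left_cancel₀ (alternant_zero_ne_zero k 𝕜) (by rw [mul_one]; exact h)).symm

theorem exists_corresponds_schur (𝕜 : Type u) [Field 𝕜] {lam : Fin k → ℕ} (hlam : Antitone lam) :
    ∃ F, Corresponds (lam 0) F (schur k 𝕜 lam hlam) := by
  have hd : lam 0 + k - 1 + 1 = lam 0 + k := by have := NeZero.pos k; omega
  have := corresponds_partIndex 𝕜 hd hlam le_rfl
  rw [Nat.sub_self, pow_zero, one_mul] at this
  exact ⟨_, this⟩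

end Schemes

/-! ### Strata -/

section Strata

variable {k : ℕ} {K : Type w} [Field K]

theorem wedge_ne_zero_of_linearIndependent {Q : Type*} [AddCommGroup Q] [Module K Q] {l : ℕ}
    {u : Fin l → Q} (hu : LinearIndependent K u) : exteriorPower.ιMulti K l u ≠ 0 := by
  intro h0
  have hinj : LinearMap.ker (Fintype.linearCombination K u) = ⊥ := by
    rw [LinearMap.ker_eq_bot']
    intro c hc
    funext i
    exact Fintype.linearIndependent_iff.1 hu c (by simpa [Fintype.linearCombination_apply] using hc) i
  obtain ⟨φ, hφ⟩ := LinearMap.exists_leftInverse_of_injective _ hinj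
  have h1 := apply_eq_zero_of_wedge_eq_zero (detForms fun j => LinearMap.proj j ∘ₗ φ) h0
  rw [detForms_apply] at h1
  have h2 : (Matrix.of fun i j => (LinearMap.proj j ∘ₗ φ : Q →ₗ[K] K) (u i)) =
      (1 : Matrix (Fin l) (Fin l) K) := by
    ext i j
    have h3 := congrFun (LinearMap.congr_fun hφ (Pi.single i 1)) j
    simpa [Matrix.one_apply, Pi.single_apply, eq_comm] using h3
  rw [h2, Matrix.det_one] at h1
  exact one_ne_zero h1

/-- Both sides say that the classes of the monomials of `U` are linearly dependent in `Q_d`, which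
over a field is the vanishing of their wedge. -/
theorem tropRank_lt_iff (J : HilbPoint k K) {d : ℕ} (U : Finset (Fin (d + 1))) :
    tropRank J d U < U.card ↔ J ∈ dependenceScheme k U K := by
  have hker : (J.piece d).comap (Fintype.linearCombination K fun s : U => mono K d s) =
      LinearMap.ker (Fintype.linearCombination K fun s : U => (J.piece d).mkQ (mono K d s)) := by
    ext c
    rw [Submodule.mem_comap, LinearMap.mem_ker, Fintype.linearCombination_apply,
      Fintype.linearCombination_apply]
    simp only [← map_smul, ← map_sum]
    exact (Submodule.Quotient.mk_eq_zero _).symm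
  have hdim := Submodule.finrank_quotient_add_finrank
    ((J.piece d).comap (Fintype.linearCombination K fun s : U => mono K d s))
  rw [Module.finrank_fintype_fun_eq_card, Fintype.card_coe] at hdim
  have hli : LinearIndependent K (fun s : U => (J.piece d).mkQ (mono K d s)) ↔
      ¬ tropRank J d U < U.card := by
    rw [tropRank, ← hdim, Nat.lt_add_right_iff_pos, not_lt, Nat.le_zero,
      Submodule.finrank_eq_zero, hker, LinearMap.ker_eq_bot']
    rw [Fintype.linearIndependent_iff]
    refine forall_congr' fun c => imp_congr (by rw [Fintype.linearCombination_apply]) ?_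
    exact funext_iff.symm
  have hli' : LinearIndependent K (fun i => (J.piece d).mkQ (mono K d (U.orderEmbOfFin rfl i))) ↔
      ¬ tropRank J d U < U.card := by
    rw [← hli]
    exact linearIndependent_equiv (U.orderIsoOfFin rfl).toEquiv
      (f := fun s : U => (J.piece d).mkQ (mono K d s))
  rw [← not_iff_not, ← hli']
  refine ⟨fun h => wedge_ne_zero_of_linearIndependent h, fun h => ?_⟩
  by_contra hcon
  exact h ((exteriorPower.ιMulti K U.card).map_linearDependent _ hcon)

variable {𝕜 : Type u} [Field 𝕜] [Algebra 𝕜 K] [NeZero k] {A : Type v} [CommRing A] [Algebra 𝕜 A]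

/-- Reduces the conditions for all `d` and `U` to those for `k`-element sets. Its right side is
shared with `mem_generatedStratum_iff`. -/
theorem mem_matroidStratum_iff (J : HilbPoint k K) (I : HilbPoint k A) :
    I ∈ matroidStratum k (tropRank J) A ↔
      ∀ (h : ℕ) (lam : Fin k → ℕ) (hlam : Antitone lam), lam 0 ≤ h →
        (J ∈ vanishingScheme h (elem k 𝕜 0 ^ (h - lam 0) * schur k 𝕜 lam hlam) K →
          I ∈ vanishingScheme h (elem k 𝕜 0 ^ (h - lam 0) * schur k 𝕜 lam hlam) A) ∧
        (J ∉ vanishingScheme h (elem k 𝕜 0 ^ (h - lam 0) * schur k 𝕜 lam hlam) K →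
          I ∈ vanishingCompl h (elem k 𝕜 0 ^ (h - lam 0) * schur k 𝕜 lam hlam) A) := by
  have hk := NeZero.pos k
  simp only [matroidStratum, Set.mem_ofPred_eq, tropRank_lt_iff]
  constructor
  · intro H h lam hlam hh
    have := H _ (monomialSet h lam)
    rwa [mem_dependenceScheme_iff (𝕜 := 𝕜) hlam hh, mem_dependenceScheme_iff (𝕜 := 𝕜) hlam hh,
      mem_dependenceCompl_iff (𝕜 := 𝕜) hlam hh] at this
  · intro H d U
    rcases lt_or_ge d k with hdk | hdk
    · have hinj : Function.Injective fun i => U.orderEmbOfFin rfl i :=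
        (U.orderEmbOfFin rfl).injective
      refine ⟨fun hJ => ?_, fun _ p => I.residue_wedgeFamily_ne_zero_of_lt hdk hinj p⟩
      refine absurd ?_ (J.residue_wedgeFamily_ne_zero_of_lt hdk hinj ⟨⊥, Ideal.isPrime_bot⟩)
      exact (congrArg _ hJ).trans (TensorProduct.tmul_zero _ _)
    obtain ⟨h, rfl⟩ : ∃ h, d = h + k - 1 := ⟨d + 1 - k, by omega⟩
    have hd : h + k - 1 + 1 = h + k := by omega
    have key : ∀ w : Fin k → Fin (h + k - 1 + 1), Function.Injective w →
        (J.wedgeFamily w = 0 → I.wedgeFamily w = 0) ∧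
        (J.wedgeFamily w ≠ 0 → ∀ p : PrimeSpectrum A,
          (1 : p.asIdeal.ResidueField) ⊗ₜ[A] I.wedgeFamily w ≠ 0) := by
      intro w hw
      obtain ⟨lam, hlam, hh, himg⟩ := exists_partition w hw
      have h1 := H h lam hlam hh
      rw [← mem_dependenceScheme_iff hlam hh, ← mem_dependenceScheme_iff hlam hh,
        ← mem_dependenceCompl_iff hlam hh, ← himg] at h1
      have hI := I.wedge_image_eq_zero_iff hw
      have hJ := J.wedge_image_eq_zero_iff hw
      exact ⟨fun h => hI.1.1 (h1.1 (hJ.1.2 h)),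
        fun h p => (hI.2 p).not.1 (h1.2 (hJ.1.not.2 h) p)⟩
    constructor
    · intro hJ
      -- Every completion of `U` to `k` monomials is dependent at `J`, hence on `I`. If `U` has more
      -- than `k` elements there is no completion to check.
      refine I.wedgeFamily_eq_zero_of_append hd _ fun j z hj => ?_
      have hJz := J.wedgeFamily_append_eq_zero z hJ
      by_cases hinj : Function.Injective (Fin.append (fun i => U.orderEmbOfFin rfl i) z)
      · generalize Fin.append (fun i => U.orderEmbOfFin rfl i) z = w at hinj hJz ⊢
        generalize U.card + j = l at hj w
        subst hj
        exact (key w hinj).1 hJz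
      · exact I.wedgeFamily_eq_zero_of_not_injective hinj
    · intro hJ p
      by_contra hI
      -- An independent `U` has a completion to `k` monomials with nonzero wedge at `J`; that wedge
      -- stays nonzero on `I` at `p`, hence so does its factor `U`.
      refine hJ (J.wedgeFamily_eq_zero_of_append hd _ fun j z hj => ?_)
      by_contra hJz
      have hinj : Function.Injective (Fin.append (fun i => U.orderEmbOfFin rfl i) z) := by
        by_contra hinj
        exact hJz (J.wedgeFamily_eq_zero_of_not_injective hinj)
      refine I.residue_wedgeFamily_ne_zero_of_append z p ?_ hI
      generalize Fin.append (fun i => U.orderEmbOfFin rfl i) z = w at hinj hJz ⊢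
      generalize U.card + j = l at hj w
      subst hj
      exact (key w hinj).2 hJz p

theorem mem_generatedStratum_iff (J : HilbPoint k K) (I : HilbPoint k A) :
    I ∈ generatedStratum (schurFamily k 𝕜) J A ↔
      ∀ (h : ℕ) (lam : Fin k → ℕ) (hlam : Antitone lam), lam 0 ≤ h →
        (J ∈ vanishingScheme h (elem k 𝕜 0 ^ (h - lam 0) * schur k 𝕜 lam hlam) K →
          I ∈ vanishingScheme h (elem k 𝕜 0 ^ (h - lam 0) * schur k 𝕜 lam hlam) A) ∧
        (J ∉ vanishingScheme h (elem k 𝕜 0 ^ (h - lam 0) * schur k 𝕜 lam hlam) K →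
          I ∈ vanishingCompl h (elem k 𝕜 0 ^ (h - lam 0) * schur k 𝕜 lam hlam) A) := by
  constructor
  · intro H h lam hlam hh
    obtain ⟨F, hF⟩ := exists_corresponds_schur 𝕜 hlam
    obtain ⟨E, hE⟩ : ∃ E, Corresponds 1 E (elem k 𝕜 0) := ⟨_, corresponds_elem_zero⟩
    have hprod := (hE.pow (h - lam 0)).mul hF
    rw [one_mul, Nat.sub_add_cancel hh] at hprod
    obtain ⟨hE1, hE2⟩ := H _ (Or.inl rfl)
    obtain ⟨hF1, hF2⟩ := H _ (Or.inr ⟨lam, hlam, rfl⟩)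
    simp only [hE.mem_vanishingScheme_iff, hE.mem_vanishingCompl_iff] at hE1 hE2
    simp only [hF.mem_vanishingScheme_iff, hF.mem_vanishingCompl_iff] at hF1 hF2
    simp only [hprod.mem_vanishingScheme_iff, hprod.mem_vanishingCompl_iff]
    constructor
    · intro hJ f hf
      rw [evalCoeffs_pow_mul]
      by_cases hJF : ∀ f ∈ J.piece k, evalCoeffs F (f : MvPolynomial (Fin 2) K) = 0
      · rw [hF1 hJF f hf, mul_zero]
      -- If `s_λ` does not vanish at `J`, then neither does its value at a generator of `J_k`, so
      -- the power of `e_0` must vanish there, with a positive exponent.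
      have hJE : h - lam 0 ≠ 0 ∧ ∀ f ∈ J.piece k,
          evalCoeffs E (f : MvPolynomial (Fin 2) K) = 0 := by
        obtain ⟨f₀, hf₀, hgen⟩ := J.exists_local_generator (𝕜 := 𝕜) ⟨⊥, Ideal.isPrime_bot⟩
        simp only [Ideal.mem_bot] at hgen
        have h1 := hgen _ F hF.1 (by simpa using hJF)
        have h2 := hJ f₀ hf₀
        rw [evalCoeffs_pow_mul] at h2
        have h3 := (mul_eq_zero.1 h2).resolve_right h1
        refine ⟨fun h => by simp [h] at h3, ?_⟩
        by_contra hcon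
        exact hgen _ _ hE.1 (by simpa using hcon) (pow_eq_zero_iff
          (fun h => by simp [h] at h3) |>.1 h3)
      rw [hE1 hJE.2 f hf, zero_pow hJE.1, zero_mul]
    · intro hJ p
      -- The forms witnessing that `e_0` and `s_λ` are nonzero at `p` may differ; a local generator
      -- witnesses both, and so their product.
      obtain ⟨f₀, hf₀, hgen⟩ := I.exists_local_generator (𝕜 := 𝕜) p
      have h1 : evalCoeffs F (f₀ : MvPolynomial (Fin 2) A) ∉ p.asIdeal := by
        refine hgen _ F hF.1 (hF2 (fun hcon => hJ fun f hf => ?_) p)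
        rw [evalCoeffs_pow_mul, hcon f hf, mul_zero]
      have h2 : evalCoeffs E (f₀ : MvPolynomial (Fin 2) A) ^ (h - lam 0) ∉
          p.asIdeal := by
        rcases Nat.eq_zero_or_pos (h - lam 0) with h0 | hpos
        · rw [h0, pow_zero]
          exact fun h => p.2.ne_top ((Ideal.eq_top_iff_one _).2 h)
        · refine fun hmem => hgen _ _ hE.1 (hE2 (fun hcon => hJ fun f hf => ?_) p)
            (p.2.mem_of_pow_mem _ hmem)
          rw [evalCoeffs_pow_mul, hcon f hf, zero_pow hpos.ne', zero_mul]
      refine ⟨f₀, hf₀, fun hmem => ?_⟩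
      rw [evalCoeffs_pow_mul] at hmem
      exact (p.2.mem_or_mem hmem).elim h2 h1
  · rintro H g (rfl | ⟨lam, hlam, rfl⟩)
    -- The section `e_0` itself is the product for `h = 1` and `λ = 0`, since `s_0 = 1`.
    · have h0 : Antitone (0 : Fin k → ℕ) := antitone_const
      have := H 1 0 h0 zero_le_one
      rw [schur_zero k 𝕜 h0] at this
      simpa only [Pi.zero_apply, Nat.sub_zero, pow_one, mul_one] using this
    · have := H (lam 0) lam hlam le_rfl
      simpa only [Nat.sub_self, pow_zero, one_mul] using this

end Strata

end HilbP1

end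

theorem theorem3p5 {𝕜 : Type u} [Field 𝕜] (k : ℕ) [NeZero k] :
    (∀ (h : ℕ) (lam : Fin k → ℕ) (hlam : Antitone lam), 1 ≤ h → lam 0 ≤ h →
      ∀ (A : Type v) [CommRing A] [Algebra 𝕜 A],
        HilbP1.dependenceScheme k (HilbP1.monomialSet h lam) A =
          HilbP1.vanishingScheme h
            (HilbP1.elem k 𝕜 0 ^ (h - lam 0) * HilbP1.schur k 𝕜 lam hlam) A) ∧
    (∀ (K : Type w) [Field K] [Algebra 𝕜 K] (J : HilbP1.HilbPoint k K)
      (A : Type v) [CommRing A] [Algebra 𝕜 A],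
        HilbP1.matroidStratum k (HilbP1.tropRank J) A =
          HilbP1.generatedStratum (HilbP1.schurFamily k 𝕜) J A) := by
  refine ⟨fun h lam hlam _ hh A _ _ => ?_, fun K _ _ J A _ _ => ?_⟩
  · ext I
    exact HilbP1.mem_dependenceScheme_iff hlam hh I
  · ext I
    exact (HilbP1.mem_matroidStratum_iff (𝕜 := 𝕜) J I).trans
      (HilbP1.mem_generatedStratum_iff J I).symm
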